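/- **Setting.** Let $H$ be a finitely generated non-amenable (discrete) group and let $G := \mathbb{Z}_2 \times H$, where $\mathbb{Z}_2=\{0,1\}$. Let $X = \{x_{ij}\}_{i,j\in\mathbb{N}}$, $Y = \{y_i\}_{i\in\mathbb{N}}$, $Z = \{z_i\}_{i\in\mathbb{N}}$ be countably infinite sets, let $\epsilon$ be a further point, and put $$\mathcal{G} := X \sqcup (\mathbb{Z}_2\times Y) \sqcup (G\times Z)\sqcup (G\times\{\epsilon\}),$$ a bundle of groups over $\mathcal{G}^{(0)} = X\sqcup Y\sqcup Z\sqcup\{\epsilon\}$: source and range of an arrow are both the base point over which it lies, and the product in each fiber is that of the trivial group, $\mathbb{Z}_2$, $G$, $G$ respectively. Consider the following basic subsets of $\mathcal{G}^{(0)}$: the singletons $\{x\}$ $(x \in X)$ and $\{z\}$ $(z\in Z)$; the sets $U_{y_i,F} := \{y_i\}\cup\{x_{ij} : j \in\mathbb{N}\}\setminus F$ with $F$ a finite subset of $\{x_{ij} : j\in\mathbb{N}\}$; and the sets $\mathcal{G}^{(0)}\setminus\big(\bigcup_{y\in F_Y}U_{y,\emptyset}\cup F_Z\big)$ with $F_Y\subseteq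 Y$, $F_Z\subseteq Z$ finite. For $g=(n,h)\in G$ let $U_g := X\sqcup(\{n\}\times Y)\sqcup(\{g\}\times Z)\sqcup(\{g\}\times\{\epsilon\})$. The topology of $\mathcal{G}$ is generated by the sets $U_gU$ of all arrows of $U_g$ with source in $U$, for $g\in G$ and $U$ a basic subset of $\mathcal{G}^{(0)}$. Let $\mathcal{C}(\mathcal{G})$ be the linear span of the functions in $C_c(U)$ (continuous and compactly supported on $U$, extended by $0$ to $\mathcal{G}$), where $U$ runs over the open bisections of $\mathcal{G}$, and let $A(\mathcal{G}) \subseteq \mathcal{C}(\mathcal{G})$ be the Steinberg algebra, the span of the indicator functions of compact open bisections. For a unit $w$, let $\lambda_w$ be the left regular representation of $\mathcal{C}(\mathcal{G})$ on $\ell^2(\mathcal{G}w)$, $\lambda_w(f)\delta_\gamma = \sum_{s(\alpha)=r(\gamma)} f(\alpha)\delta_{\alpha\gamma}$, and let $C^*_{r}(\mathcal{G})$ be the completion of $\mathcal{C}(\mathcal{G})$ in the reduced norm $\|f\| := \sup_{w\in\mathcal{G}^{(0)}}\|\lambda_w(f)\|$. Elements of $C^*_{r}(\mathcal{G})$ are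 regarded as bounded functions on $\mathcal{G}$ through the unique contractive extension (for the supremum norm) of the inclusion of $\mathcal{C}(\mathcal{G})$ into the bounded functions. Let $J\subseteq C^*_{r}(\mathcal{G})$ be the ideal of singular functions, that is, of those $f$ for which $\{\gamma\in\mathcal{G} : f(\gamma)\neq 0\}$ has empty interior. **Theorem.** $\mathcal{G}$ is an ample groupoid, and $J\cap\mathcal{C}(\mathcal{G})$ is not dense in $J$ (in the reduced norm). In particular, $J\cap A(\mathcal{G})$ is not dense in $J$ either. -/

import Mathlib

open Set Topology
open scoped ENNReal

/-! ### Amenability -/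

/-- A (discrete) group is amenable if it carries a finitely additive, left-invariant probability
measure defined on all of its subsets. -/
def IsAmenableGroup (H : Type*) [Group H] : Prop :=
  ∃ m : Set H → ℝ, (∀ A, 0 ≤ m A) ∧ m univ = 1 ∧
    (∀ A B, Disjoint A B → m (A ∪ B) = m A + m B) ∧
    ∀ (h : H) (A : Set H), m ((fun k => h * k) '' A) = m A

/-! ### Groupoids, viewed as sets of arrows -/

/-- A groupoid, presented through its set of arrows; objects are identified with the identity
arrows (units). The product `comp a b _` is defined exactly when the source of `a` is the range
of `b`. -/
class ArrowGroupoid (𝒢 : Type*) where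
  src : 𝒢 → 𝒢
  rng : 𝒢 → 𝒢
  inv : 𝒢 → 𝒢
  comp : ∀ a b : 𝒢, src a = rng b → 𝒢
  src_src : ∀ a, src (src a) = src a
  rng_src : ∀ a, rng (src a) = src a
  src_rng : ∀ a, src (rng a) = rng a
  rng_rng : ∀ a, rng (rng a) = rng a
  src_inv : ∀ a, src (inv a) = rng a
  rng_inv : ∀ a, rng (inv a) = src a
  src_comp : ∀ a b h, src (comp a b h) = src b
  rng_comp : ∀ a b h, rng (comp a b h) = rng a
  comp_assoc : ∀ a b c (h : src a = rng b) (k : src b = rng c),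
    comp (comp a b h) c ((src_comp a b h).trans k) =
      comp a (comp b c k) (h.trans (rng_comp b c k).symm)
  comp_src : ∀ a, comp a (src a) (rng_src a).symm = a
  rng_comp_self : ∀ a, comp (rng a) a (src_rng a) = a
  inv_comp : ∀ a, comp (inv a) a (src_inv a) = src a
  comp_inv : ∀ a, comp a (inv a) (rng_inv a).symm = rng a

namespace ArrowGroupoid

section Algebra

variable (𝒢 : Type*) [ArrowGroupoid 𝒢]

/-- The unit space. -/
def units : Set 𝒢 := {u | src u = u}

variable {𝒢}

theorem comp_congr {a b c d : 𝒢} (h : src a = rng b) (k : src c = rng d) (hac : a = c)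
    (hbd : b = d) : comp a b h = comp c d k := by
  subst hac; subst hbd; rfl

/-- The arrows with source `w`. -/
abbrev Fiber (w : units 𝒢) : Type _ := {γ : 𝒢 // src γ = (w : 𝒢)}

/-- `η γ⁻¹`, for arrows `η`, `γ` with the same source. -/
def mulInv {w : units 𝒢} (η γ : Fiber w) : 𝒢 :=
  comp η.1 (inv γ.1) ((η.2.trans γ.2.symm).trans (rng_inv γ.1).symm)

theorem rng_mulInv {w : units 𝒢} (η γ : Fiber w) : rng (mulInv η γ) = rng η.1 := rng_comp _ _ _

theorem src_mulInv {w : units 𝒢} (η γ : Fiber w) : src (mulInv η γ) = rng γ.1 :=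
  (src_comp _ _ _).trans (src_inv _)

theorem mulInv_comp {w : units 𝒢} (η γ : Fiber w) :
    comp (mulInv η γ) γ.1 (src_mulInv η γ) = η.1 := by
  have h1 := comp_assoc η.1 (inv γ.1) γ.1
    ((η.2.trans γ.2.symm).trans (rng_inv γ.1).symm) (src_inv γ.1)
  have h2 : comp η.1 (comp (inv γ.1) γ.1 (src_inv γ.1))
      (((η.2.trans γ.2.symm).trans (rng_inv γ.1).symm).trans (rng_comp _ _ _).symm) = η.1 :=
    (comp_congr _ _ rfl ((inv_comp γ.1).trans (γ.2.trans η.2.symm))).trans (comp_src η.1)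
  exact h1.trans h2

theorem inv_mulInv_comp {w : units 𝒢} (η γ : Fiber w) :
    comp (inv (mulInv η γ)) η.1 ((src_inv _).trans (rng_mulInv η γ)) = γ.1 := by
  have h0 : comp (inv (mulInv η γ)) η.1 ((src_inv _).trans (rng_mulInv η γ)) =
      comp (inv (mulInv η γ)) (comp (mulInv η γ) γ.1 (src_mulInv η γ))
        ((src_inv _).trans (rng_comp _ _ _).symm) :=
    comp_congr _ _ rfl (mulInv_comp η γ).symm
  have h1 := comp_assoc (inv (mulInv η γ)) (mulInv η γ) γ.1 (src_inv _) (src_mulInv η γ)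
  have h2 : comp (comp (inv (mulInv η γ)) (mulInv η γ) (src_inv _)) γ.1
      ((src_comp _ _ _).trans (src_mulInv η γ)) = γ.1 :=
    (comp_congr _ _ ((inv_comp _).trans (src_mulInv η γ)) rfl).trans (rng_comp_self γ.1)
  exact h0.trans (h1.symm.trans h2)

/-- The unit `w`, as an element of the fiber over itself. -/
def unitArrow (w : units 𝒢) : Fiber w := ⟨w, w.2⟩

/-- The unit `s(γ)`. -/
def srcUnit (γ : 𝒢) : units 𝒢 := ⟨src γ, src_src γ⟩

/-- The arrow `γ`, as an element of the fiber over its source. -/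
def toFiber (γ : 𝒢) : Fiber (srcUnit γ) := ⟨γ, rfl⟩

end Algebra

/-! ### Topological groupoids and their function spaces -/

section Topology

variable (𝒢 : Type*) [ArrowGroupoid 𝒢] [TopologicalSpace 𝒢]

variable {𝒢} in
/-- A bisection: source and range restrict to homeomorphisms onto their images. -/
def IsBisection (B : Set 𝒢) : Prop :=
  IsEmbedding (fun γ : B => src (γ : 𝒢)) ∧ IsEmbedding (fun γ : B => rng (γ : 𝒢))

/-- Ample groupoids: topological groupoids with locally compact Hausdorff unit space and open
source map, whose topology has a basis of compact open bisections. The space of arrows need not be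
Hausdorff. -/
structure IsAmple : Prop where
  continuous_src : Continuous (src : 𝒢 → 𝒢)
  continuous_rng : Continuous (rng : 𝒢 → 𝒢)
  continuous_inv : Continuous (inv : 𝒢 → 𝒢)
  continuous_comp : Continuous
    (fun p : {p : 𝒢 × 𝒢 // src p.1 = rng p.2} => comp p.1.1 p.1.2 p.2)
  t2_units : T2Space (units 𝒢)
  locallyCompact_units : LocallyCompactSpace (units 𝒢)
  isOpenMap_src : IsOpenMap (src : 𝒢 → 𝒢)
  basis : TopologicalSpace.IsTopologicalBasis {B : Set 𝒢 | IsOpen B ∧ IsCompact B ∧ IsBisection B}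

variable {𝒢} in
/-- `C_c(U)`: functions that are continuous and compactly supported on `U`, extended by `0`. -/
def IsCcOn (U : Set 𝒢) (f : 𝒢 → ℂ) : Prop :=
  Continuous (fun γ : U => f γ) ∧ HasCompactSupport (fun γ : U => f γ) ∧ ∀ γ, γ ∉ U → f γ = 0

/-- `𝒞(𝒢)`: the span of the functions in `C_c(U)`, over all open bisections `U`. -/
def algC : Submodule ℂ (𝒢 → ℂ) :=
  Submodule.span ℂ {f | ∃ U : Set 𝒢, IsOpen U ∧ IsBisection U ∧ IsCcOn U f}

/-- The Steinberg algebra `A(𝒢)`: the span of the indicator functions of compact open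
bisections. -/
noncomputable def steinberg : Submodule ℂ (𝒢 → ℂ) :=
  Submodule.span ℂ {f | ∃ U : Set 𝒢, IsOpen U ∧ IsCompact U ∧ IsBisection U ∧
    f = U.indicator (fun _ => (1 : ℂ))}

theorem steinberg_le_algC : steinberg 𝒢 ≤ algC 𝒢 := by
  refine Submodule.span_mono ?_
  rintro f ⟨U, hU, hUc, hUb, rfl⟩
  refine ⟨U, hU, hUb, ?_, ?_, ?_⟩
  · have : (fun γ : U => U.indicator (fun _ => (1 : ℂ)) (γ : 𝒢)) = fun _ => 1 := by
      ext γ; simp [γ.2]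
    rw [this]; exact continuous_const
  · have := isCompact_iff_compactSpace.mp hUc
    exact (isClosed_tsupport _).isCompact
  · intro γ hγ
    simp [hγ]

end Topology

/-! ### The left regular representations -/

/-- The Hilbert space `ℓ²(ι)`. -/
abbrev Ell2 (ι : Type*) : Type _ := lp (fun _ : ι => ℂ) 2

open Classical in
/-- The canonical orthonormal basis vectors of `ℓ²(ι)`. -/
noncomputable def delta {ι : Type*} (i : ι) : Ell2 ι := lp.single 2 i (1 : ℂ)

theorem ext_delta {ι : Type*} {S T : Ell2 ι →L[ℂ] Ell2 ι}
    (h : ∀ i j, S (delta i) j = T (delta i) j) : S = T := by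
  classical
  have h' : ∀ i, S (delta i) = T (delta i) := fun i => lp.ext (funext (h i))
  ext1 ξ
  have key : ∀ R : Ell2 ι →L[ℂ] Ell2 ι, HasSum (fun i => ξ i • R (delta i)) (R ξ) := by
    intro R
    have h1 := (lp.hasSum_single (by simp) ξ).mapL R
    convert h1 using 2 with i
    rw [← map_smul, delta, ← lp.single_smul]
    simp
  have hS := key S
  simp only [h'] at hS
  exact hS.unique (key T)

/-- A bounded matrix with at most one nonzero entry in every row and in every column defines a
bounded operator. -/
theorem exists_operator {ι : Type*} (k : ι → ι → ℂ) (C : ℝ) (hC0 : 0 ≤ C)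
    (hC : ∀ i j, ‖k i j‖ ≤ C)
    (hrow : ∀ i j j', k i j ≠ 0 → k i j' ≠ 0 → j = j')
    (hcol : ∀ i i' j, k i j ≠ 0 → k i' j ≠ 0 → i = i') :
    ∃ T : Ell2 ι →L[ℂ] Ell2 ι, ‖T‖ ≤ C ∧ ∀ j i, T (delta j) i = k i j := by
  classical
  have hp : ∀ i, ∃ p, ∀ j, k i j ≠ 0 → j = p := by
    intro i
    by_cases h : ∃ j, k i j ≠ 0
    · obtain ⟨j, hj⟩ := h
      exact ⟨j, fun j' hj' => hrow i j' j hj' hj⟩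
    · push Not at h
      exact ⟨i, fun j hj => absurd (h j) hj⟩
  choose p hp using hp
  have two : (0 : ℝ) < (2 : ℝ≥0∞).toReal := by norm_num
  have hinj : Function.Injective (fun i : {i // k i (p i) ≠ 0} => p i.1) := by
    intro a b hab
    have hab' : p a.1 = p b.1 := hab
    exact Subtype.ext (hcol a.1 b.1 (p a.1) a.2 (by rw [hab']; exact b.2))
  have hbound : ∀ (ξ : Ell2 ι) (s : Finset ι),
      ∑ i ∈ s, ‖k i (p i) * ξ (p i)‖ ^ (2 : ℝ≥0∞).toReal ≤ (C * ‖ξ‖) ^ (2 : ℝ≥0∞).toReal := by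
    intro ξ s
    have e1 : ∑ i ∈ s, ‖k i (p i) * ξ (p i)‖ ^ (2 : ℝ≥0∞).toReal =
        ∑ i ∈ s with k i (p i) ≠ 0, ‖k i (p i) * ξ (p i)‖ ^ (2 : ℝ≥0∞).toReal := by
      rw [Finset.sum_filter]
      refine Finset.sum_congr rfl fun i _ => ?_
      split_ifs with h
      · rfl
      · push Not at h
        simp [h]
    have e2 : ∀ i, ‖k i (p i) * ξ (p i)‖ ^ (2 : ℝ≥0∞).toReal ≤
        C ^ (2 : ℝ≥0∞).toReal * ‖ξ (p i)‖ ^ (2 : ℝ≥0∞).toReal := by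
      intro i
      rw [norm_mul, Real.mul_rpow (norm_nonneg _) (norm_nonneg _)]
      gcongr
      exact hC _ _
    have inj : Set.InjOn p ↑(s.filter fun i => k i (p i) ≠ 0) := by
      intro a ha b hb hab
      have ha' := (Finset.mem_filter.mp (Finset.mem_coe.mp ha)).2
      have hb' := (Finset.mem_filter.mp (Finset.mem_coe.mp hb)).2
      exact congrArg Subtype.val (@hinj ⟨a, ha'⟩ ⟨b, hb'⟩ hab)
    calc _ ≤ ∑ i ∈ s with k i (p i) ≠ 0,
          C ^ (2 : ℝ≥0∞).toReal * ‖ξ (p i)‖ ^ (2 : ℝ≥0∞).toReal := by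
            rw [e1]; exact Finset.sum_le_sum fun i _ => e2 i
      _ = C ^ (2 : ℝ≥0∞).toReal *
          ∑ j ∈ (s.filter fun i => k i (p i) ≠ 0).image p, ‖ξ j‖ ^ (2 : ℝ≥0∞).toReal := by
            rw [Finset.sum_image inj, Finset.mul_sum]
      _ ≤ C ^ (2 : ℝ≥0∞).toReal * ‖ξ‖ ^ (2 : ℝ≥0∞).toReal := by
            gcongr
            exact lp.sum_rpow_le_norm_rpow two ξ _
      _ = _ := (Real.mul_rpow hC0 (norm_nonneg _)).symm
  let T₀ : Ell2 ι →ₗ[ℂ] Ell2 ι :=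
    { toFun := fun ξ => ⟨fun i => k i (p i) * ξ (p i), memℓp_gen' (hbound ξ)⟩
      map_add' := fun ξ ζ => by
        ext i
        change k i (p i) * (ξ + ζ : Ell2 ι) (p i) = _
        rw [lp.coeFn_add, Pi.add_apply, mul_add]
        rfl
      map_smul' := fun c ξ => by
        ext i
        change k i (p i) * (c • ξ : Ell2 ι) (p i) = c • (k i (p i) * ξ (p i))
        rw [lp.coeFn_smul, Pi.smul_apply, smul_eq_mul, smul_eq_mul]
        ring }
  have hT₀ : ∀ ξ, ‖T₀ ξ‖ ≤ C * ‖ξ‖ := fun ξ =>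
    lp.norm_le_of_forall_sum_le two (by positivity) (hbound ξ)
  refine ⟨T₀.mkContinuous C hT₀, T₀.mkContinuous_norm_le hC0 hT₀, fun j i => ?_⟩
  change k i (p i) * (delta j : Ell2 ι) (p i) = k i j
  by_cases h : p i = j
  · subst h
    simp [delta]
  · have h0 : k i j = 0 := by
      by_contra hne
      exact h (hp i j hne).symm
    simp [delta, h, h0]

section Regular

variable {𝒢 : Type*} [ArrowGroupoid 𝒢] [TopologicalSpace 𝒢]

/-- For `f` in `𝒞(𝒢)` the operators `λ_w(f)` exist and are uniformly bounded. -/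
theorem exists_leftRegular {f : 𝒢 → ℂ} (hf : f ∈ algC 𝒢) :
    ∃ C : ℝ, ∀ w : units 𝒢, ∃ T : Ell2 (Fiber w) →L[ℂ] Ell2 (Fiber w),
      ‖T‖ ≤ C ∧ ∀ γ η : Fiber w, T (delta γ) η = f (mulInv η γ) := by
  induction hf using Submodule.span_induction with
  | mem f hf =>
    obtain ⟨U, -, hUb, hc, hs, h0⟩ := hf
    obtain ⟨C, hC⟩ := hs.exists_bound_of_continuous hc
    refine ⟨max C 0, fun w => ?_⟩
    have hU : ∀ γ, f γ ≠ 0 → γ ∈ U := fun γ hγ => by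
      by_contra h
      exact hγ (h0 γ h)
    refine exists_operator (fun η γ : Fiber w => f (mulInv η γ)) (max C 0)
      (le_max_right _ _) ?_ ?_ ?_
    · intro η γ
      by_cases h : mulInv η γ ∈ U
      · exact (hC ⟨_, h⟩).trans (le_max_left _ _)
      · rw [h0 _ h]; simp
    · intro η γ γ' h h'
      have e : mulInv η γ = mulInv η γ' := congrArg Subtype.val
        (@hUb.2.injective ⟨_, hU _ h⟩ ⟨_, hU _ h'⟩ ((rng_mulInv η γ).trans (rng_mulInv η γ').symm))
      refine Subtype.ext ?_
      rw [← inv_mulInv_comp η γ, ← inv_mulInv_comp η γ']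
      exact comp_congr _ _ (congrArg inv e) rfl
    · intro η η' γ h h'
      have e : mulInv η γ = mulInv η' γ := congrArg Subtype.val
        (@hUb.1.injective ⟨_, hU _ h⟩ ⟨_, hU _ h'⟩ ((src_mulInv η γ).trans (src_mulInv η' γ).symm))
      refine Subtype.ext ?_
      rw [← mulInv_comp η γ, ← mulInv_comp η' γ]
      exact comp_congr _ _ e rfl
  | zero => exact ⟨0, fun w => ⟨0, by simp, fun γ η => by simp⟩⟩
  | add f g _ _ hf hg =>
    obtain ⟨C, hC⟩ := hf
    obtain ⟨D, hD⟩ := hg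
    refine ⟨C + D, fun w => ?_⟩
    obtain ⟨S, hS, hS'⟩ := hC w
    obtain ⟨T, hT, hT'⟩ := hD w
    exact ⟨S + T, (norm_add_le _ _).trans (add_le_add hS hT), fun γ η => by simp [hS', hT']⟩
  | smul c f _ hf =>
    obtain ⟨C, hC⟩ := hf
    refine ⟨‖c‖ * C, fun w => ?_⟩
    obtain ⟨S, hS, hS'⟩ := hC w
    refine ⟨c • S, ?_, fun γ η => by simp [hS']⟩
    rw [norm_smul]
    gcongr

/-- The left regular representation `λ_w` at a unit `w`: for `f` in `𝒞(𝒢)`, `λ_w(f)` is the unique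
bounded operator on `ℓ²(𝒢w)` with `λ_w(f) δ_γ = ∑ f(α) δ_{αγ}`, the sum being over all `α` with
`s(α) = r(γ)`; in other words, the coefficient of `λ_w(f) δ_γ` at `η` is `f(ηγ⁻¹)`. -/
noncomputable def leftRegular (w : units 𝒢) (f : algC 𝒢) : Ell2 (Fiber w) →L[ℂ] Ell2 (Fiber w) :=
  ((exists_leftRegular f.2).choose_spec w).choose

theorem leftRegular_delta (w : units 𝒢) (f : algC 𝒢) (γ η : Fiber w) :
    leftRegular w f (delta γ) η = (f : 𝒢 → ℂ) (mulInv η γ) :=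
  ((exists_leftRegular f.2).choose_spec w).choose_spec.2 γ η

theorem exists_norm_leftRegular_le (f : algC 𝒢) :
    ∃ C : ℝ, ∀ w : units 𝒢, ‖leftRegular w f‖ ≤ C :=
  ⟨_, fun w => ((exists_leftRegular f.2).choose_spec w).choose_spec.1⟩

end Regular

/-! ### The reduced C*-algebra and the singular functions -/

section Reduced

variable (𝒢 : Type*) [ArrowGroupoid 𝒢] [TopologicalSpace 𝒢]

/-- Bounded families of operators on the spaces `ℓ²(𝒢w)`, with the supremum of the operator
norms. -/
abbrev OperatorFamilies : Type _ :=
  lp (fun w : units 𝒢 => Ell2 (Fiber w) →L[ℂ] Ell2 (Fiber w)) ∞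

/-- The map `f ↦ (λ_w(f))_w`. The norm of the image of `f` is the reduced norm of `f`, that is,
`sup_w ‖λ_w(f)‖`. -/
noncomputable def regRep : algC 𝒢 →ₗ[ℂ] OperatorFamilies 𝒢 where
  toFun f := ⟨fun w => leftRegular w f, memℓp_infty (by
    obtain ⟨C, hC⟩ := exists_norm_leftRegular_le f
    exact ⟨C, by rintro _ ⟨w, rfl⟩; exact hC w⟩)⟩
  map_add' f g := by
    refine lp.ext (funext fun w => ext_delta fun γ η => ?_)
    change leftRegular w (f + g) (delta γ) η =
      (leftRegular w f (delta γ) + leftRegular w g (delta γ) : Ell2 (Fiber w)) η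
    simp [leftRegular_delta]
  map_smul' c f := by
    refine lp.ext (funext fun w => ext_delta fun γ η => ?_)
    change leftRegular w (c • f) (delta γ) η = (c • leftRegular w f (delta γ) : Ell2 (Fiber w)) η
    simp [leftRegular_delta]

/-- The reduced C*-algebra of `𝒢`, the completion of `𝒞(𝒢)` in the reduced norm, realised as the
closure of the image of `𝒞(𝒢)` in the complete space of bounded operator families. -/
noncomputable def redAlg : Submodule ℂ (OperatorFamilies 𝒢) :=
  (LinearMap.range (regRep 𝒢)).topologicalClosure

variable {𝒢}

/-- The canonical map from `𝒞(𝒢)` to the reduced C*-algebra. -/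
noncomputable def toRedAlg (f : algC 𝒢) : redAlg 𝒢 :=
  ⟨regRep 𝒢 f, Submodule.le_topologicalClosure _ ⟨f, rfl⟩⟩

/-- The function on `𝒢` given by an element of the reduced C*-algebra: its value at `γ` is the
coefficient at `γ` of the image of `δ_{s(γ)}`. By `jMap_toRedAlg` and `norm_jMap_le` this is the
unique extension of the inclusion of `𝒞(𝒢)` into the functions on `𝒢` that is contractive for the
supremum norm. -/
noncomputable def jMap (a : redAlg 𝒢) (γ : 𝒢) : ℂ :=
  (a : OperatorFamilies 𝒢) (srcUnit γ) (delta (unitArrow (srcUnit γ))) (toFiber γ)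

theorem jMap_toRedAlg (f : algC 𝒢) : jMap (toRedAlg f) = (f : 𝒢 → ℂ) := by
  funext γ
  have h := leftRegular_delta (srcUnit γ) f (unitArrow (srcUnit γ)) (toFiber γ)
  refine h.trans (congrArg _ ?_)
  have hu : inv (src γ) = src γ := by
    have h1 := comp_src (inv (src γ))
    have h2 := inv_comp (src γ)
    have e : src (inv (src γ)) = src γ := (src_inv _).trans (rng_src γ)
    have h3 : comp (inv (src γ)) (src (inv (src γ))) (rng_src _).symm =
        comp (inv (src γ)) (src γ) (src_inv _) := comp_congr _ _ rfl e
    exact h1.symm.trans (h3.trans (h2.trans (src_src γ)))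
  exact (comp_congr _ _ rfl hu).trans (comp_src γ)

theorem jMap_sub (a b : redAlg 𝒢) (γ : 𝒢) : jMap (a - b) γ = jMap a γ - jMap b γ := rfl

theorem norm_jMap_le (a : redAlg 𝒢) (γ : 𝒢) :
    ‖jMap a γ‖ ≤ ‖(a : OperatorFamilies 𝒢)‖ := by
  have h1 := lp.norm_apply_le_norm (by simp) (a : OperatorFamilies 𝒢) (srcUnit γ)
  have hd : ‖(delta (unitArrow (srcUnit γ)) : Ell2 _)‖ = 1 := by
    unfold delta
    exact (@lp.norm_single _ _ _ _ (Classical.decEq _) (by norm_num) _ _).trans norm_one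
  refine (lp.norm_apply_le_norm (by simp) _ _).trans ?_
  refine (ContinuousLinearMap.le_opNorm _ _).trans ?_
  rw [hd, mul_one]
  exact h1

variable (𝒢)

/-- The set `J` of singular functions: the elements of the reduced C*-algebra whose (open) support
has empty interior. -/
def singularIdeal : Set (redAlg 𝒢) :=
  {a | interior (Function.support (jMap a)) = ∅}

end Reduced

end ArrowGroupoid

/-! ### The bundle of groups -/

/-- The points `x_{ij}`, `y_i`, `z_i`, `ε`. -/
inductive BasePoint : Type
  | x (i j : ℕ) : BasePoint
  | y (i : ℕ) : BasePoint
  | z (i : ℕ) : BasePoint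
  | eps : BasePoint

namespace BasePoint

/-- `U_{y_i,F}`: the point `y_i` together with the `x_{ij}`, `j ∉ F`. -/
def nhdY (i : ℕ) (F : Finset ℕ) : Set BasePoint :=
  {y i} ∪ {p | ∃ j, j ∉ F ∧ p = x i j}

/-- `U_{F_Y,F_Z}`: the complement of the union of `F_Z` and of the `U_{y,∅}`, `y ∈ F_Y`. -/
def nhdEps (FY FZ : Finset ℕ) : Set BasePoint :=
  ((⋃ i ∈ FY, nhdY i ∅) ∪ {p | ∃ i ∈ FZ, p = z i})ᶜ

/-- The basis of compact open sets of the unit space. -/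
def basicSets : Set (Set BasePoint) :=
  {U | (∃ i j, U = {x i j}) ∨ (∃ i, U = {z i}) ∨ (∃ i F, U = nhdY i F) ∨
    ∃ FY FZ, U = nhdEps FY FZ}

end BasePoint

/-- The group `ℤ₂`, written multiplicatively. -/
abbrev Z2 : Type := Multiplicative (ZMod 2)

/-- The arrows `X ⊔ (ℤ₂ × Y) ⊔ (G × Z) ⊔ (G × {ε})`, where `G = ℤ₂ × H`. -/
inductive GroupBundle (H : Type*) : Type _
  | x (i j : ℕ) : GroupBundle H
  | y (n : Z2) (i : ℕ) : GroupBundle H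
  | z (g : Z2 × H) (i : ℕ) : GroupBundle H
  | eps (g : Z2 × H) : GroupBundle H

namespace GroupBundle

variable {H : Type*}

/-- The base point over which an arrow lies. -/
def base : GroupBundle H → BasePoint
  | x i j => .x i j
  | y _ i => .y i
  | z _ i => .z i
  | eps _ => .eps

/-- The arrow of `U_g` over a given base point, where, for `g = (n, h)`,
`U_g = X ⊔ ({n} × Y) ⊔ ({g} × Z) ⊔ ({g} × {ε})`. -/
def arrow (g : Z2 × H) : BasePoint → GroupBundle H
  | .x i j => x i j
  | .y i => y g.1 i
  | .z i => z g i
  | .eps => eps g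

/-- The group operation in the fibers. -/
def mul [Group H] : ∀ a b : GroupBundle H, base a = base b → GroupBundle H
  | x i j, x _ _, _ => x i j
  | y n i, y m _, _ => y (n * m) i
  | z g i, z h _, _ => z (g * h) i
  | eps g, eps h, _ => eps (g * h)

/-- Inversion in the fibers. -/
def inverse [Group H] : GroupBundle H → GroupBundle H
  | x i j => x i j
  | y n i => y n⁻¹ i
  | z g i => z g⁻¹ i
  | eps g => eps g⁻¹

theorem base_arrow (g : Z2 × H) (p : BasePoint) : base (arrow g p) = p := by
  cases p <;> rfl

theorem arrow_one_injective [Group H] {p q : BasePoint}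
    (h : arrow (1 : Z2 × H) p = arrow 1 q) : p = q := by
  rw [← base_arrow (1 : Z2 × H) p, h, base_arrow]

/-- Source and range of an arrow are both the identity of the fiber that contains it. -/
instance [Group H] : ArrowGroupoid (GroupBundle H) where
  src a := arrow 1 (base a)
  rng a := arrow 1 (base a)
  inv := inverse
  comp a b h := mul a b (arrow_one_injective h)
  src_src a := by rw [base_arrow]
  rng_src a := by rw [base_arrow]
  src_rng a := by rw [base_arrow]
  rng_rng a := by rw [base_arrow]
  src_inv a := by cases a <;> rfl
  rng_inv a := by cases a <;> rfl
  src_comp a b h := by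
    have h' := arrow_one_injective h
    cases a <;> cases b <;> simp_all [base, mul]
  rng_comp a b h := by
    have h' := arrow_one_injective h
    cases a <;> cases b <;> simp_all [base, mul]
  comp_assoc a b c h k := by
    have h' := arrow_one_injective h
    have k' := arrow_one_injective k
    cases a <;> cases b <;> cases c <;> simp_all [base, mul, mul_assoc]
  comp_src a := by cases a <;> simp [base, mul, arrow]
  rng_comp_self a := by cases a <;> simp [base, mul, arrow]
  inv_comp a := by cases a <;> simp [base, mul, arrow, inverse]
  comp_inv a := by cases a <;> simp [base, mul, arrow, inverse]

/-- The topology with basis the sets `U_g U` of the arrows of `U_g` with source in `U`, where `U`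
runs over the basic compact open sets of the unit space. -/
instance : TopologicalSpace (GroupBundle H) :=
  TopologicalSpace.generateFrom {S | ∃ g : Z2 × H, ∃ U ∈ BasePoint.basicSets, S = arrow g '' U}

end GroupBundle

/-! The proof separates an element of `J` from `J ∩ 𝒞(𝒢)` by its behaviour along `Y` near `eps`.

A function in `𝒞(𝒢)` involves finitely many bisections, each with at most one arrow over `eps`. Near
`eps` it is therefore governed by a finitely supported `c` on `G`. Its limit along `z g i` is `c g`,
and its limit along `y n i` is the sum of `c` over all `g` with first coordinate `n`
(`exists_tendsto_of_mem_algC`). The arrows over `Z` are isolated, so a singular function vanishes on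
them. Then `c = 0`, and the function tends to `0` along `Y`.

Completing in the reduced norm breaks this link between `Z` and `Y`. The function `1_{U_(0,1)} -
1_{U_(1,1)}` is `0` over `X` and `±1` over `Y`, but it is not singular, being nonzero over `Z`.
Multiply it by powers of an averaging element `μ` of `ℂ[H]`. Over `X` and `Y` the group `H` acts
trivially and `μ` acts as the identity. Over `Z` and `eps` the fiber maps equivariantly to `H` with
left translation, so non-amenability gives `‖μ‖ ≤ r < 1` there, uniformly in the unit
(`exists_norm_sum_translate_le`). The products converge in the reduced norm to an element supported
on the arrows over `Y` (`limitFamily_mem_redAlg`). It is singular because each such arrow is a limit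
of the `x i j`, and its value at every `y 1 i` is `1`. The reduced norm dominates the supremum norm,
so no singular function in `𝒞(𝒢)` comes close to it.

Ampleness rests on `isOpen_iff_preimage_arrow`: the arrow space is glued from copies of a compact,
totally separated unit space along open sets. -/

open Filter

/-! ### The unit space: a compact, totally separated topology with `basicSets` as a basis -/

namespace BasePoint

@[simp] theorem x_mem_nhdY {i j k : ℕ} {F : Finset ℕ} : x i j ∈ nhdY k F ↔ i = k ∧ j ∉ F := by
  simp only [nhdY, mem_union, mem_singleton_iff, reduceCtorEq, false_or, mem_ofPred_eq, x.injEq]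
  constructor
  · rintro ⟨j, h, rfl, rfl⟩; exact ⟨rfl, h⟩
  · rintro ⟨rfl, h⟩; exact ⟨j, h, rfl, rfl⟩

@[simp] theorem y_mem_nhdY {i k : ℕ} {F : Finset ℕ} : y i ∈ nhdY k F ↔ i = k := by simp [nhdY]

@[simp] theorem z_mem_nhdY {i k : ℕ} {F : Finset ℕ} : z i ∉ nhdY k F := by simp [nhdY]

@[simp] theorem eps_mem_nhdY {k : ℕ} {F : Finset ℕ} : eps ∉ nhdY k F := by simp [nhdY]

@[simp] theorem x_mem_nhdEps {i j : ℕ} {FY FZ : Finset ℕ} : x i j ∈ nhdEps FY FZ ↔ i ∉ FY := by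
  simp [nhdEps]

@[simp] theorem y_mem_nhdEps {i : ℕ} {FY FZ : Finset ℕ} : y i ∈ nhdEps FY FZ ↔ i ∉ FY := by
  simp [nhdEps]

@[simp] theorem z_mem_nhdEps {i : ℕ} {FY FZ : Finset ℕ} : z i ∈ nhdEps FY FZ ↔ i ∉ FZ := by
  simp [nhdEps]

@[simp] theorem eps_mem_nhdEps {FY FZ : Finset ℕ} : eps ∈ nhdEps FY FZ := by simp [nhdEps]

/-- The topology of the unit space: `x i j` and `z i` are isolated, `x i j → y i` as `j → ∞`, and
`eps` is the point at infinity of the `z i` and of the sets `nhdY i ∅`. -/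
instance : TopologicalSpace BasePoint where
  IsOpen S := (∀ i, y i ∈ S → ∀ᶠ j in cofinite, x i j ∈ S) ∧
    (eps ∈ S → (∀ᶠ i in cofinite, z i ∈ S) ∧ ∀ᶠ i in cofinite, nhdY i ∅ ⊆ S)
  isOpen_univ := by simp
  isOpen_inter S T hS hT := by
    refine ⟨fun i h => (hS.1 i h.1).and (hT.1 i h.2), fun h => ?_⟩
    refine ⟨(hS.2 h.1).1.and (hT.2 h.2).1, ?_⟩
    filter_upwards [(hS.2 h.1).2, (hT.2 h.2).2] with i h1 h2 using subset_inter h1 h2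
  isOpen_sUnion C hC := by
    refine ⟨?_, ?_⟩
    · rintro i ⟨S, hS, h⟩
      filter_upwards [(hC S hS).1 i h] with j hj using ⟨S, hS, hj⟩
    · rintro ⟨S, hS, h⟩
      refine ⟨?_, ?_⟩
      · filter_upwards [((hC S hS).2 h).1] with j hj using ⟨S, hS, hj⟩
      · filter_upwards [((hC S hS).2 h).2] with j hj using hj.trans (subset_sUnion_of_mem hS)

theorem isOpen_def {S : Set BasePoint} :
    IsOpen S ↔ (∀ i, y i ∈ S → ∀ᶠ j in cofinite, x i j ∈ S) ∧
      (eps ∈ S → (∀ᶠ i in cofinite, z i ∈ S) ∧ ∀ᶠ i in cofinite, nhdY i ∅ ⊆ S) := Iff.rfl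

theorem eventually_notMem (F : Finset ℕ) : ∀ᶠ i in cofinite, i ∉ F := by
  simp [eventually_cofinite]

theorem eventually_ne_cofinite_nat (i : ℕ) : ∀ᶠ k in cofinite, k ≠ i := by
  simp [eventually_cofinite]

theorem isOpen_of_mem_basicSets {U : Set BasePoint} (hU : U ∈ basicSets) : IsOpen U := by
  rw [isOpen_def]
  obtain ⟨i, j, rfl⟩ | ⟨i, rfl⟩ | ⟨i, F, rfl⟩ | ⟨FY, FZ, rfl⟩ := hU
  · simp
  · simp
  · refine ⟨fun k hk => ?_, by simp⟩
    obtain rfl := y_mem_nhdY.1 hk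
    simp
  · refine ⟨fun k hk => ?_, fun _ => ⟨?_, ?_⟩⟩
    · simp [y_mem_nhdEps.1 hk]
    · simp
    · filter_upwards [eventually_notMem FY] with i hi
      rintro (_ | _ | _ | _) h <;> simp at h <;> simp [h, hi]

theorem exists_basicSets_subset {S : Set BasePoint} (hS : IsOpen S) {p : BasePoint} (hp : p ∈ S) :
    ∃ U ∈ basicSets, p ∈ U ∧ U ⊆ S := by
  rw [isOpen_def] at hS
  rcases p with ⟨i, j⟩ | i | i | _
  · exact ⟨{x i j}, .inl ⟨i, j, rfl⟩, rfl, by simpa⟩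
  · have h := hS.1 i hp
    rw [eventually_cofinite] at h
    refine ⟨nhdY i h.toFinset, .inr (.inr (.inl ⟨i, _, rfl⟩)), by simp, ?_⟩
    rintro (_ | _ | _ | _) h <;> simp at h
    · obtain ⟨rfl, h⟩ := h; exact h
    · rwa [h]
  · exact ⟨{z i}, .inr (.inl ⟨i, rfl⟩), rfl, by simpa⟩
  · obtain ⟨hz, hy⟩ := hS.2 hp
    rw [eventually_cofinite] at hz hy
    refine ⟨nhdEps hy.toFinset hz.toFinset, .inr (.inr (.inr ⟨_, _, rfl⟩)), by simp, ?_⟩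
    rintro (_ | _ | _ | _) h <;> simp at h
    · exact h (by simp)
    · exact h (by simp)
    · exact h
    · exact hp

theorem isClopen_x (i j : ℕ) : IsClopen {x i j} := by
  refine ⟨⟨?_⟩, isOpen_of_mem_basicSets (.inl ⟨i, j, rfl⟩)⟩
  rw [isOpen_def]
  refine ⟨fun k _ => ?_, fun _ => ⟨by simp, ?_⟩⟩
  · filter_upwards [eventually_ne_cofinite_nat j] with l hl
    simp [hl]
  · filter_upwards [eventually_ne_cofinite_nat i] with l hl
    simp [subset_compl_singleton_iff, hl.symm]

theorem isClopen_z (i : ℕ) : IsClopen {z i} := by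
  refine ⟨⟨?_⟩, isOpen_of_mem_basicSets (.inr (.inl ⟨i, rfl⟩))⟩
  rw [isOpen_def]
  refine ⟨fun k _ => by simp, fun _ => ⟨?_, by simp⟩⟩
  filter_upwards [eventually_ne_cofinite_nat i] with l hl
  simp [hl]

theorem isClopen_nhdY (i : ℕ) : IsClopen (nhdY i ∅) := by
  refine ⟨⟨?_⟩, isOpen_of_mem_basicSets (.inr (.inr (.inl ⟨i, _, rfl⟩)))⟩
  have : (nhdY i ∅)ᶜ = nhdEps {i} ∅ := by simp [nhdEps]
  rw [this]
  exact isOpen_of_mem_basicSets (.inr (.inr (.inr ⟨_, _, rfl⟩)))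

/-- Supplies the Hausdorff property and, with compactness, the clopen neighbourhoods from which
compact open bisections are made. -/
instance : TotallySeparatedSpace BasePoint := by
  rw [totallySeparatedSpace_iff_exists_isClopen]
  -- The separating set may contain either point, since complements of clopen sets are clopen. It
  -- thus suffices that one of the two points is distinguished by a clopen set.
  have key : ∀ p q : BasePoint, p ≠ q → ∃ U, IsClopen U ∧ (p ∈ U ∧ q ∉ U ∨ q ∈ U ∧ p ∉ U) := by
    intro p q h
    have hx : ∀ i j, p = x i j ∨ q = x i j → ∃ U, IsClopen U ∧ (p ∈ U ∧ q ∉ U ∨ q ∈ U ∧ p ∉ U) := by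
      rintro i j (rfl | rfl)
      · exact ⟨_, isClopen_x i j, .inl ⟨rfl, h.symm⟩⟩
      · exact ⟨_, isClopen_x i j, .inr ⟨rfl, h⟩⟩
    have hz : ∀ i, p = z i ∨ q = z i → ∃ U, IsClopen U ∧ (p ∈ U ∧ q ∉ U ∨ q ∈ U ∧ p ∉ U) := by
      rintro i (rfl | rfl)
      · exact ⟨_, isClopen_z i, .inl ⟨rfl, h.symm⟩⟩
      · exact ⟨_, isClopen_z i, .inr ⟨rfl, h⟩⟩
    rcases p with ⟨i, j⟩ | i | i | _
    · exact hx i j (.inl rfl)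
    · rcases q with ⟨k, l⟩ | k | k | _
      · exact hx k l (.inr rfl)
      · exact ⟨_, isClopen_nhdY i, .inl ⟨by simp, by simpa [eq_comm] using h⟩⟩
      · exact hz k (.inr rfl)
      · exact ⟨_, isClopen_nhdY i, .inl ⟨by simp, by simp⟩⟩
    · exact hz i (.inl rfl)
    · rcases q with ⟨k, l⟩ | k | k | _
      · exact hx k l (.inr rfl)
      · exact ⟨_, isClopen_nhdY k, .inr ⟨by simp, by simp⟩⟩
      · exact hz k (.inr rfl)
      · exact absurd rfl h
  intro p q h
  obtain ⟨U, hU, h | h⟩ := key p q h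
  · exact ⟨U, hU, h.1, h.2⟩
  · exact ⟨Uᶜ, hU.compl, h.2, fun h' => h' h.1⟩

theorem tendsto_x (i : ℕ) : Tendsto (fun j => x i j) cofinite (𝓝 (y i)) :=
  tendsto_nhds.2 fun _ hS h => (isOpen_def.1 hS).1 i h

theorem tendsto_y : Tendsto y cofinite (𝓝 eps) :=
  tendsto_nhds.2 fun _ hS h => ((isOpen_def.1 hS).2 h).2.mono fun _ hi => hi (y_mem_nhdY.2 rfl)

theorem tendsto_z : Tendsto z cofinite (𝓝 eps) :=
  tendsto_nhds.2 fun _ hS h => ((isOpen_def.1 hS).2 h).1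

theorem isCompact_nhdY (i : ℕ) : IsCompact (nhdY i ∅) := by
  convert (tendsto_x i).isCompact_insert_range_of_cofinite using 1
  ext p
  rcases p with _ | _ | _ | _ <;> simp [eq_comm]

/-- The complement is a closed subset of finitely many `z i` and finitely many compact sets `nhdY i
∅`. An ultrafilter that does not converge to `eps` contains such a complement, whence compactness of
the whole space. -/
theorem isCompact_compl {S : Set BasePoint} (hS : IsOpen S) (h : eps ∈ S) : IsCompact Sᶜ := by
  obtain ⟨hz, hy⟩ := (isOpen_def.1 hS).2 h
  rw [eventually_cofinite] at hz hy
  refine IsCompact.of_isClosed_subset ((hz.image z).isCompact.union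
    (hy.isCompact_biUnion fun i _ => isCompact_nhdY i)) hS.isClosed_compl ?_
  intro p hp
  have hY : ∀ i, p ∈ nhdY i ∅ → p ∈ ⋃ i ∈ {i | ¬ nhdY i ∅ ⊆ S}, nhdY i ∅ := fun i hi =>
    mem_biUnion (show i ∈ {i | ¬ nhdY i ∅ ⊆ S} from fun hs => hp (hs hi)) hi
  rcases p with ⟨i, j⟩ | i | i | _
  · exact .inr (hY i (by simp))
  · exact .inr (hY i (by simp))
  · exact .inl ⟨i, hp, rfl⟩
  · exact absurd h hp

instance : CompactSpace BasePoint := by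
  refine ⟨isCompact_iff_ultrafilter_le_nhds.2 fun f _ => ?_⟩
  by_cases hf : (f : Filter BasePoint) ≤ 𝓝 eps
  · exact ⟨eps, mem_univ _, hf⟩
  · rw [(nhds_basis_opens eps).ge_iff] at hf
    push Not at hf
    obtain ⟨V, ⟨hV, hVo⟩, hVf⟩ := hf
    obtain ⟨p, -, hp⟩ := isCompact_iff_ultrafilter_le_nhds.1 (isCompact_compl hVo hV) f
      (le_principal_iff.2 (Ultrafilter.compl_mem_iff_notMem.2 hVf))
    exact ⟨p, mem_univ _, hp⟩

end BasePoint

/-! ### The topology on arrows as the final topology for the sections `U_g` -/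

namespace GroupBundle

open BasePoint ArrowGroupoid

variable {H : Type*}

theorem arrow_injective (g : Z2 × H) : Function.Injective (arrow g) :=
  Function.LeftInverse.injective (base_arrow g)

/-- All sections coincide over `X`, so agreement at `y i` extends to its neighbourhood `nhdY i ∅`,
and agreement at `eps` forces `g = g'`. This openness makes the sections open maps. The set need not
be closed, so the arrow space need not be Hausdorff. -/
theorem isOpen_agree (g g' : Z2 × H) : IsOpen {p | arrow g p = arrow g' p} := by
  rw [isOpen_def]
  refine ⟨fun i _ => by simp [arrow], fun h => ?_⟩
  obtain rfl : g = g' := eps.inj h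
  simp

theorem preimage_arrow_image (g g' : Z2 × H) (U : Set BasePoint) :
    arrow g' ⁻¹' (arrow g '' U) = U ∩ {p | arrow g p = arrow g' p} := by
  ext p
  constructor
  · rintro ⟨q, hq, h⟩
    obtain rfl : q = p := by rw [← base_arrow g q, h, base_arrow]
    exact ⟨hq, h⟩
  · rintro ⟨hp, h⟩
    exact ⟨p, hp, h⟩

theorem exists_eq_arrow [Nonempty H] (a : GroupBundle H) : ∃ g, a = arrow g (base a) := by
  obtain ⟨h⟩ := ‹Nonempty H›
  rcases a with _ | ⟨n, _⟩ | ⟨g, _⟩ | g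
  · exact ⟨(1, h), rfl⟩
  · exact ⟨(n, h), rfl⟩
  · exact ⟨g, rfl⟩
  · exact ⟨g, rfl⟩

/-- The topology is the final topology for the sections `arrow g`. -/
theorem isOpen_iff_preimage_arrow [Nonempty H] {S : Set (GroupBundle H)} :
    IsOpen S ↔ ∀ g, IsOpen (arrow g ⁻¹' S) := by
  constructor
  · intro hS g
    refine (continuous_generateFrom_iff.2 ?_ : Continuous (arrow g)).isOpen_preimage S hS
    rintro _ ⟨g', U, hU, rfl⟩
    rw [preimage_arrow_image]
    exact (isOpen_of_mem_basicSets hU).inter (isOpen_agree g' g)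
  · intro hS
    rw [isOpen_iff_forall_mem_open]
    intro a ha
    obtain ⟨g, hg⟩ := exists_eq_arrow a
    obtain ⟨U, hU, haU, hUS⟩ := exists_basicSets_subset (hS g) (p := base a) (by
      rwa [mem_preimage, ← hg])
    exact ⟨arrow g '' U, image_subset_iff.2 hUS, .basic _ ⟨g, U, hU, rfl⟩, base a, haU, hg.symm⟩

variable [Nonempty H]

theorem continuous_iff_comp_arrow {X : Type*} [TopologicalSpace X] {f : GroupBundle H → X} :
    Continuous f ↔ ∀ g, Continuous (f ∘ arrow g) := by
  simp only [continuous_def, isOpen_iff_preimage_arrow, preimage_comp]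
  exact ⟨fun h g U hU => h U hU g, fun h U hU g => h g U hU⟩

theorem continuous_arrow (g : Z2 × H) : Continuous (arrow g) :=
  continuous_def.2 fun _ hS => isOpen_iff_preimage_arrow.1 hS g

theorem isOpenMap_arrow (g : Z2 × H) : IsOpenMap (arrow g) := fun U hU =>
  isOpen_iff_preimage_arrow.2 fun g' => by
    rw [preimage_arrow_image]
    exact hU.inter (isOpen_agree g g')

theorem continuous_base : Continuous (base : GroupBundle H → BasePoint) :=
  continuous_iff_comp_arrow.2 fun g => by
    convert continuous_id
    exact funext (base_arrow g)

end GroupBundle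

/-! ### Ampleness of the groupoid -/

namespace GroupBundle

open BasePoint ArrowGroupoid

variable {H : Type*} [Group H]

theorem src_def (a : GroupBundle H) : src a = arrow 1 (base a) := rfl

theorem src_arrow (g : Z2 × H) (p : BasePoint) : src (arrow g p) = arrow 1 p := by
  rw [src_def, base_arrow]

theorem continuous_src : Continuous (src : GroupBundle H → GroupBundle H) :=
  (continuous_arrow 1).comp continuous_base

theorem inv_arrow (g : Z2 × H) (p : BasePoint) : inv (arrow g p) = arrow g⁻¹ p := by
  cases p <;> rfl

theorem comp_arrow (g h : Z2 × H) (p : BasePoint) (e : src (arrow g p) = rng (arrow h p)) :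
    comp (arrow g p) (arrow h p) e = arrow (g * h) p := by
  cases p <;> rfl

theorem isBisection_image_arrow (g : Z2 × H) (U : Set BasePoint) : IsBisection (arrow g '' U) := by
  have h : IsEmbedding (fun γ : arrow g '' U => src (γ : GroupBundle H)) := by
    -- On `arrow g '' U` the map `arrow g ∘ base` recovers an arrow from its source. Range and
    -- source agree, so the same embedding serves for both.
    refine .of_comp (g := arrow g ∘ base) (continuous_src.comp continuous_subtype_val)
      ((continuous_arrow g).comp continuous_base) ?_
    convert IsEmbedding.subtypeVal (p := (· ∈ arrow g '' U)) using 1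
    ext γ
    obtain ⟨_, p, -, rfl⟩ := γ
    simp [src_def, base_arrow]
  exact ⟨h, h⟩

theorem units_eq_range : units (GroupBundle H) = range (arrow 1) := by
  ext a
  exact ⟨fun h => ⟨_, h⟩, by rintro ⟨p, rfl⟩; exact src_arrow 1 p⟩

/-- Locally, on pairs lying in `U_g` and `U_h`, the product is the section `arrow (g * h)` at the
common base point. -/
theorem continuous_comp : Continuous (fun p : {p : GroupBundle H × GroupBundle H //
    src p.1 = rng p.2} => comp p.1.1 p.1.2 p.2) := by
  rw [continuous_iff_continuousAt]
  rintro ⟨⟨a, b⟩, hab⟩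
  obtain ⟨g, hg⟩ := exists_eq_arrow a
  obtain ⟨h, hh⟩ := exists_eq_arrow b
  refine ((continuous_arrow (g * h)).comp (continuous_base.comp
    (continuous_fst.comp continuous_subtype_val))).continuousAt.congr ?_
  have h1 : IsOpen {p : {p : GroupBundle H × GroupBundle H // src p.1 = rng p.2} |
      p.1.1 ∈ range (arrow g) ∧ p.1.2 ∈ range (arrow h)} :=
    ((isOpenMap_arrow g).isOpen_range.preimage (continuous_fst.comp continuous_subtype_val)).inter
      ((isOpenMap_arrow h).isOpen_range.preimage (continuous_snd.comp continuous_subtype_val))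
  filter_upwards [h1.mem_nhds ⟨⟨_, hg.symm⟩, ⟨_, hh.symm⟩⟩]
  rintro ⟨⟨_, _⟩, e⟩ ⟨⟨p, rfl⟩, ⟨q, rfl⟩⟩
  obtain rfl : p = q := by
    have e' : src (arrow g p) = src (arrow h q) := e
    rw [src_arrow, src_arrow] at e'
    exact arrow_one_injective e'
  simp only [Function.comp_apply, base_arrow]
  exact (comp_arrow g h p e).symm

instance : T2Space (units (GroupBundle H)) :=
  .of_injective_continuous (f := fun w : units (GroupBundle H) => base w.1)
    (fun v w h => Subtype.ext (by
      rw [← show src v.1 = v.1 from v.2, ← show src w.1 = w.1 from w.2]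
      exact congrArg (arrow 1) h))
    (continuous_base.comp continuous_subtype_val)

theorem isAmple : IsAmple (GroupBundle H) where
  continuous_src := continuous_src
  continuous_rng := continuous_src
  continuous_inv := continuous_iff_comp_arrow.2 fun g => by
    convert continuous_arrow g⁻¹ using 1
    exact funext (inv_arrow g)
  continuous_comp := continuous_comp
  t2_units := inferInstance
  locallyCompact_units := by
    have : CompactSpace (units (GroupBundle H)) := by
      rw [← isCompact_iff_compactSpace, units_eq_range]
      exact isCompact_range (continuous_arrow 1)
    infer_instance
  isOpenMap_src S hS := by
    have : src '' S = ⋃ g, arrow 1 '' (arrow g ⁻¹' S) := by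
      ext a
      simp only [mem_image, mem_iUnion, mem_preimage]
      constructor
      · rintro ⟨b, hb, rfl⟩
        obtain ⟨g, hg⟩ := exists_eq_arrow b
        exact ⟨g, base b, hg ▸ hb, rfl⟩
      · rintro ⟨g, p, hp, rfl⟩
        exact ⟨_, hp, src_arrow g p⟩
    rw [this]
    exact isOpen_iUnion fun g => isOpenMap_arrow 1 _ (isOpen_iff_preimage_arrow.1 hS g)
  basis := by
    refine TopologicalSpace.isTopologicalBasis_of_isOpen_of_nhds (fun B hB => hB.1) ?_
    intro a S ha hS
    obtain ⟨g, hg⟩ := exists_eq_arrow a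
    obtain ⟨V, hV, haV, hVS⟩ := compact_exists_isClopen_in_isOpen
      (isOpen_iff_preimage_arrow.1 hS g) (x := base a) (by rwa [mem_preimage, ← hg])
    exact ⟨arrow g '' V, ⟨isOpenMap_arrow g _ hV.isOpen,
      hV.isClosed.isCompact.image (continuous_arrow g), isBisection_image_arrow g V⟩,
      ⟨base a, haV, hg.symm⟩, image_subset_iff.2 hVS⟩

/-! ### Limits of functions in `𝒞(𝒢)` -/

theorem tendsto_arrow_x (g : Z2 × H) (i : ℕ) :
    Tendsto (fun j => (x i j : GroupBundle H)) cofinite (𝓝 (y g.1 i)) :=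
  ((continuous_arrow g).tendsto _).comp (tendsto_x i)

theorem tendsto_arrow_y (g : Z2 × H) :
    Tendsto (fun i => (y g.1 i : GroupBundle H)) cofinite (𝓝 (eps g)) :=
  ((continuous_arrow g).tendsto _).comp tendsto_y

theorem tendsto_arrow_z (g : Z2 × H) :
    Tendsto (fun i => (z g i : GroupBundle H)) cofinite (𝓝 (eps g)) :=
  ((continuous_arrow g).tendsto _).comp tendsto_z

theorem isOpen_singleton_z (g : Z2 × H) (i : ℕ) : IsOpen {(z g i : GroupBundle H)} := by
  convert isOpenMap_arrow g _ (isClopen_z i).isOpen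
  simp [arrow]

theorem IsBisection.eq_of_mem {B : Set (GroupBundle H)} (hB : IsBisection B) {a b : GroupBundle H}
    (ha : a ∈ B) (hb : b ∈ B) (h : base a = base b) : a = b :=
  congrArg Subtype.val (@hB.1.injective ⟨a, ha⟩ ⟨b, hb⟩ (congrArg (arrow 1) h))

/-- A compact set that contains no arrow over `eps` meets only finitely many of the sets over
`y i` and over `z i`. -/
theorem eventually_notMem_of_isCompact {K : Set (GroupBundle H)} (hK : IsCompact K)
    (he : ∀ g, eps g ∉ K) : ∀ᶠ i in cofinite, (∀ n, y n i ∉ K) ∧ ∀ g, z g i ∉ K := by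
  -- `K` need not be closed in the non-Hausdorff arrow space, but its image in the Hausdorff base
  -- is.
  have hb := hK.image continuous_base
  have hopen := hb.isClosed.isOpen_compl
  have hmem : BasePoint.eps ∈ (base '' K)ᶜ := by
    rintro ⟨a, ha, h⟩
    rcases a with _ | _ | _ | g <;> cases h
    exact he g ha
  filter_upwards [tendsto_y (hopen.mem_nhds hmem), tendsto_z (hopen.mem_nhds hmem)] with i h1 h2
  exact ⟨fun n h => h1 ⟨_, h, rfl⟩, fun g h => h2 ⟨_, h, rfl⟩⟩

/-- The limits of a function in `𝒞(𝒢)` along `y n i` are the fiber sums of its limits along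
`z g i`. -/
theorem exists_tendsto_of_mem_algC {f : GroupBundle H → ℂ} (hf : f ∈ algC (GroupBundle H)) :
    ∃ c : (Z2 × H) →₀ ℂ, (∀ g, Tendsto (fun i => f (z g i)) cofinite (𝓝 (c g))) ∧
      ∀ n, Tendsto (fun i => f (y n i)) cofinite
        (𝓝 (Finsupp.linearCombination ℂ (fun g : Z2 × H => if g.1 = n then (1 : ℂ) else 0) c)) := by
  classical
  induction hf using Submodule.span_induction with
  | mem f hf =>
    obtain ⟨U, hU, hB, hc, hs, h0⟩ := hf
    -- If `U` contains `eps g`, this is its only arrow over `eps`, and `U` contains `z g i` and `y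
    -- g.1 i` for almost all `i`. Injectivity of the source on `U` then excludes the other arrows
    -- over these points.
    by_cases he : ∃ g, eps g ∈ U
    · obtain ⟨g, hg⟩ := he
      have hcont : ContinuousAt f (eps g) :=
        (continuousOn_iff_continuous_domRestrict.2 hc).continuousAt (hU.mem_nhds hg)
      refine ⟨Finsupp.single g (f (eps g)), fun k => ?_, fun n => ?_⟩
      · by_cases hk : g = k
        · subst hk
          simpa [Function.comp_def] using hcont.tendsto.comp (tendsto_arrow_z g)
        · rw [Finsupp.single_eq_of_ne' hk]
          refine tendsto_const_nhds.congr' ?_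
          filter_upwards [tendsto_arrow_z g (hU.mem_nhds hg)] with i hi
          refine (h0 _ fun h => hk ?_).symm
          cases IsBisection.eq_of_mem hB hi h rfl
          rfl
      · by_cases hn : g.1 = n
        · subst hn
          simpa [Function.comp_def] using hcont.tendsto.comp (tendsto_arrow_y g)
        · simp only [Finsupp.linearCombination_single, hn, if_false, smul_zero]
          refine tendsto_const_nhds.congr' ?_
          filter_upwards [tendsto_arrow_y g (hU.mem_nhds hg)] with i hi
          refine (h0 _ fun h => hn ?_).symm
          cases IsBisection.eq_of_mem hB hi h rfl
          rfl
    · push Not at he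
      have hK : IsCompact ((↑) '' tsupport fun γ : U => f γ : Set (GroupBundle H)) :=
        hs.isCompact.image continuous_subtype_val
      have hf0 : ∀ a, a ∉ ((↑) '' tsupport fun γ : U => f γ : Set (GroupBundle H)) → f a = 0 := by
        intro a ha
        by_contra hne
        have haU : a ∈ U := by
          by_contra h
          exact hne (h0 a h)
        exact ha ⟨⟨a, haU⟩, subset_tsupport _ hne, rfl⟩
      have hev := eventually_notMem_of_isCompact hK (by
        rintro g ⟨⟨_, h⟩, -, rfl⟩
        exact he g h)
      refine ⟨0, fun g => ?_, fun n => ?_⟩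
      · refine tendsto_const_nhds.congr' ?_
        filter_upwards [hev] with i hi using (hf0 _ (hi.2 g)).symm
      · rw [map_zero]
        refine tendsto_const_nhds.congr' ?_
        filter_upwards [hev] with i hi using (hf0 _ (hi.1 n)).symm
  | zero => exact ⟨0, by simp, by simp⟩
  | add f g _ _ hf hg =>
    obtain ⟨c, hc, hc'⟩ := hf
    obtain ⟨d, hd, hd'⟩ := hg
    exact ⟨c + d, fun k => (hc k).add (hd k), fun n => by
      rw [map_add]
      exact (hc' n).add (hd' n)⟩
  | smul a f _ hf =>
    obtain ⟨c, hc, hc'⟩ := hf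
    exact ⟨a • c, fun k => (hc k).const_mul a, fun n => by
      rw [map_smul]
      exact (hc' n).const_mul a⟩

/-- Singular functions in `𝒞(𝒢)` vanish at infinity along the arrows over `Y`. -/
theorem tendsto_zero_of_interior_support_eq_empty {f : GroupBundle H → ℂ}
    (hf : f ∈ algC (GroupBundle H)) (hs : interior (Function.support f) = ∅) (n : Z2) :
    Tendsto (fun i => f (y n i)) cofinite (𝓝 0) := by
  obtain ⟨c, hc, hc'⟩ := exists_tendsto_of_mem_algC hf
  -- The arrows over `Z` are isolated, so a nonzero value there would be an interior point of the
  -- support.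
  have hz : ∀ g i, f (z g i) = 0 := by
    intro g i
    by_contra h
    have : z g i ∈ interior (Function.support f) :=
      mem_interior.2 ⟨_, singleton_subset_iff.2 h, isOpen_singleton_z g i, rfl⟩
    simp [hs] at this
  obtain rfl : c = 0 := Finsupp.ext fun g =>
    tendsto_nhds_unique (hc g) (by simp [hz])
  simpa using hc' n

end GroupBundle

/-! ### Amenability from almost invariant means -/

/-- If every finite subset of `H` leaves some finitely additive probability measure almost
invariant, then `H` is amenable. -/
theorem exists_moved_of_not_isAmenableGroup {H : Type*} [Group H] (hH : ¬ IsAmenableGroup H) :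
    ∃ S : Finset H, S.Nonempty ∧ ∃ δ : ℝ, 0 < δ ∧ ∀ m : Set H → ℝ, (∀ A, 0 ≤ m A) → m univ = 1 →
      (∀ A B, Disjoint A B → m (A ∪ B) = m A + m B) →
      ∃ s ∈ S, ∃ A : Set H, δ ≤ |m ((fun k => s * k) '' A) - m A| := by
  classical
  by_contra! hcon
  refine hH ?_
  have h1 : ∀ p : Finset H × ℕ, ∃ m : Set H → ℝ, (∀ A, 0 ≤ m A) ∧ m univ = 1 ∧
      (∀ A B, Disjoint A B → m (A ∪ B) = m A + m B) ∧
      ∀ s ∈ p.1, ∀ A : Set H, |m ((fun k => s * k) '' A) - m A| < 1 / ((p.2 : ℝ) + 1) := by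
    intro p
    -- Inserting `1` only serves to make the finite set nonempty.
    obtain ⟨m, h0, h1, h2, h3⟩ := hcon (insert 1 p.1) (Finset.insert_nonempty _ _)
      (1 / ((p.2 : ℝ) + 1)) (by positivity)
    exact ⟨m, h0, h1, h2, fun s hs => h3 s (Finset.mem_insert_of_mem hs)⟩
  choose m m0 m1 madd minv using h1
  have hle : ∀ p A, m p A ≤ 1 := by
    intro p A
    have := madd p A Aᶜ disjoint_compl_right
    rw [union_compl_self, m1] at this
    linarith [m0 p Aᶜ]
  -- Limits along an ultrafilter finer than `atTop` exist by compactness of `[0, 1]`. Eventually the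
  -- finite set contains any given `h` and the tolerance is arbitrarily small, so the limit mean is
  -- invariant.
  let 𝒰 : Ultrafilter (Finset H × ℕ) := Ultrafilter.of atTop
  have h𝒰 : (𝒰 : Filter (Finset H × ℕ)) ≤ atTop := Ultrafilter.of_le _
  have hlim : ∀ A, ∃ l : ℝ, Tendsto (fun p => m p A) 𝒰 (𝓝 l) := by
    intro A
    obtain ⟨l, -, hl⟩ := isCompact_iff_ultrafilter_le_nhds.1 (isCompact_Icc (a := (0 : ℝ)) (b := 1))
      (𝒰.map fun p => m p A) (tendsto_principal.2 (Eventually.of_forall fun p => ⟨m0 p A, hle p A⟩))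
    exact ⟨l, hl⟩
  choose M hM using hlim
  refine ⟨M, fun A => ge_of_tendsto' (hM A) (m0 · A), ?_, fun A B hAB => ?_, fun h A => ?_⟩
  · refine tendsto_nhds_unique (hM univ) ?_
    simp [m1]
  · refine tendsto_nhds_unique (hM _) ?_
    simpa only [madd _ A B hAB] using (hM A).add (hM B)
  · have hd := (hM ((fun k => h * k) '' A)).sub (hM A)
    have h0 : Tendsto (fun p : Finset H × ℕ => 1 / ((p.2 : ℝ) + 1)) 𝒰 (𝓝 0) := by
      refine Tendsto.mono_left ?_ h𝒰
      rw [← prod_atTop_atTop_eq]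
      exact tendsto_one_div_add_atTop_nhds_zero_nat.comp tendsto_snd
    have he : ∀ᶠ p in (𝒰 : Filter (Finset H × ℕ)), ‖m p ((fun k => h * k) '' A) - m p A‖ ≤
        1 / ((p.2 : ℝ) + 1) := by
      filter_upwards [h𝒰 (mem_atTop (({h} : Finset H), 0))] with p hp
      exact (minv p h (hp.1 (by simp)) A).le
    exact sub_eq_zero.1 (tendsto_nhds_unique hd (squeeze_zero_norm' he h0))

/-! ### Permutation representations on `ℓ²` and the spectral gap -/

open ArrowGroupoid

theorem Ell2.norm_sq_eq_tsum {ι : Type*} (ξ : Ell2 ι) : ‖ξ‖ ^ 2 = ∑' i, ‖ξ i‖ ^ 2 := by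
  have := lp.norm_rpow_eq_tsum (p := 2) (by norm_num) ξ
  simpa using this

theorem Ell2.summable_norm_sq {ι : Type*} (ξ : Ell2 ι) : Summable fun i => ‖ξ i‖ ^ 2 := by
  have := (lp.memℓp ξ).summable (p := 2) (by norm_num)
  simpa using this

/-- Reindexing of an `ℓ²` vector along an injection, followed by restriction to a set. -/
noncomputable def Ell2.pullback {ι : Type*} (σ : ι → ι) (hσ : σ.Injective) (A : Set ι) :
    Ell2 ι →L[ℂ] Ell2 ι :=
  LinearMap.mkContinuous
    { toFun := fun ξ => ⟨A.indicator fun i => ξ (σ i), by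
        refine memℓp_gen ?_
        simp only [ENNReal.toReal_ofNat, Real.rpow_ofNat]
        refine Summable.of_nonneg_of_le (fun i => by positivity) (fun i => ?_)
          ((Ell2.summable_norm_sq ξ).comp_injective hσ)
        by_cases h : i ∈ A <;> simp [h]⟩
      map_add' := fun ξ ζ => lp.ext (indicator_add A (fun i => ξ (σ i)) fun i => ζ (σ i))
      map_smul' := fun c ξ => lp.ext (indicator_const_smul A c fun i => ξ (σ i)) }
    1 fun ξ => by
      rw [one_mul, ← sq_le_sq₀ (norm_nonneg _) (norm_nonneg _), Ell2.norm_sq_eq_tsum,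
        Ell2.norm_sq_eq_tsum]
      refine (Summable.tsum_le_tsum (fun i => ?_) (Ell2.summable_norm_sq _)
        ((Ell2.summable_norm_sq ξ).comp_injective hσ)).trans
        (tsum_comp_le_tsum_of_inj (Ell2.summable_norm_sq ξ) (fun i => by positivity) hσ)
      by_cases h : i ∈ A <;> simp [h]

theorem Ell2.pullback_apply {ι : Type*} (σ : ι → ι) (hσ : σ.Injective) (A : Set ι) (ξ : Ell2 ι)
    (i : ι) : Ell2.pullback σ hσ A ξ i = A.indicator (fun i => ξ (σ i)) i := rfl

theorem Ell2.norm_pullback_le {ι : Type*} (σ : ι → ι) (hσ : σ.Injective) (A : Set ι) (ξ : Ell2 ι) :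
    ‖Ell2.pullback σ hσ A ξ‖ ≤ ‖ξ‖ := by
  refine (ContinuousLinearMap.le_of_opNorm_le _ ?_ ξ).trans_eq (one_mul _)
  exact LinearMap.mkContinuous_norm_le _ zero_le_one _

theorem Ell2.norm_sq_pullback {ι : Type*} (σ : ι → ι) (hσ : σ.Injective) (A : Set ι) (ξ : Ell2 ι) :
    ‖Ell2.pullback σ hσ A ξ‖ ^ 2 = ∑' i, A.indicator (fun i => ‖ξ (σ i)‖ ^ 2) i := by
  rw [Ell2.norm_sq_eq_tsum]
  refine tsum_congr fun i => ?_
  rw [Ell2.pullback_apply]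
  by_cases h : i ∈ A <;> simp [h]

/-- The permutation representation of a group on `ℓ²` of a set on which it acts. -/
noncomputable def Ell2.translate {G : Type*} [Group G] (ι : Type*) [MulAction G ι] :
    G →* (Ell2 ι →L[ℂ] Ell2 ι) where
  toFun g := Ell2.pullback (fun i => g⁻¹ • i) (MulAction.injective _) univ
  map_one' := by
    ext ξ i
    simp [Ell2.pullback_apply]
  map_mul' g h := by
    ext ξ i
    simp [Ell2.pullback_apply, mul_smul]

theorem Ell2.translate_apply {G : Type*} [Group G] {ι : Type*} [MulAction G ι] (g : G)
    (ξ : Ell2 ι) (i : ι) : Ell2.translate ι g ξ i = ξ (g⁻¹ • i) := by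
  simp [Ell2.translate, Ell2.pullback_apply]

theorem Ell2.norm_translate {G : Type*} [Group G] {ι : Type*} [MulAction G ι] (g : G)
    (ξ : Ell2 ι) : ‖Ell2.translate ι g ξ‖ = ‖ξ‖ := by
  refine le_antisymm (Ell2.norm_pullback_le _ (MulAction.injective g⁻¹) _ _) ?_
  calc ‖ξ‖ = ‖(Ell2.translate ι g⁻¹ * Ell2.translate ι g) ξ‖ := by rw [← map_mul]; simp
    _ ≤ ‖Ell2.translate ι g ξ‖ := Ell2.norm_pullback_le _ (MulAction.injective g⁻¹⁻¹) _ _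

/-- The mass that the probability density `|ξ|²` gives to the preimage of `s * A` is, up to the
displacement of `ξ` under `s⁻¹`, the mass that it gives to the preimage of `A`. -/
theorem Ell2.abs_sub_le_norm_translate_sub {G H ι : Type*} [Group G] [Group H] [MulAction G ι]
    (φ : ι → H) (g : G) (h : H) (hφ : ∀ i, φ (g • i) = h * φ i) (ξ : Ell2 ι) (hξ : ‖ξ‖ = 1)
    (A : Set H) :
    |‖Ell2.pullback id Function.injective_id (φ ⁻¹' ((fun k => h * k) '' A)) ξ‖ ^ 2 -
      ‖Ell2.pullback id Function.injective_id (φ ⁻¹' A) ξ‖ ^ 2| ≤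
      2 * ‖Ell2.translate ι g ξ - ξ‖ := by
  -- Substitute `g • i` for `i`: by equivariance `φ (g • i)` lies in `h * A` exactly when `φ i` lies
  -- in `A`.
  have e : ‖Ell2.pullback id Function.injective_id (φ ⁻¹' ((fun k => h * k) '' A)) ξ‖ ^ 2 =
      ‖Ell2.pullback id Function.injective_id (φ ⁻¹' A) (Ell2.translate ι g⁻¹ ξ)‖ ^ 2 := by
    rw [Ell2.norm_sq_pullback, Ell2.norm_sq_pullback,
      ← (MulAction.toPerm g).tsum_eq]
    refine tsum_congr fun i => ?_
    by_cases hi : φ i ∈ A <;> simp [indicator, hφ, hi, Ell2.translate_apply]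
  rw [e]
  set P := Ell2.pullback id Function.injective_id (φ ⁻¹' A)
  have h1 : |‖P (Ell2.translate ι g⁻¹ ξ)‖ - ‖P ξ‖| ≤ ‖Ell2.translate ι g ξ - ξ‖ := by
    refine (abs_norm_sub_norm_le _ _).trans ?_
    rw [← map_sub]
    refine (Ell2.norm_pullback_le _ _ _ _).trans_eq ?_
    rw [← Ell2.norm_translate g, map_sub, ← mul_apply_eq_comp, ← map_mul,
      norm_sub_rev]
    simp
  have h2 : ‖P (Ell2.translate ι g⁻¹ ξ)‖ + ‖P ξ‖ ≤ 2 := by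
    have h3 := Ell2.norm_pullback_le id Function.injective_id (φ ⁻¹' A) (Ell2.translate ι g⁻¹ ξ)
    have h4 := Ell2.norm_pullback_le id Function.injective_id (φ ⁻¹' A) ξ
    rw [Ell2.norm_translate] at h3
    linarith
  -- The difference of squares is a sum of norms, at most `2`, times a difference bounded by the
  -- displacement.
  rw [sq_sub_sq, abs_mul, abs_of_nonneg (by positivity)]
  gcongr

/-- Spectral gap: for a non-amenable group, an averaging operator in any permutation representation
that factors over the left regular action is a strict contraction, uniformly. -/
theorem exists_norm_sum_translate_le {H : Type*} [Group H] (hH : ¬ IsAmenableGroup H) :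
    ∃ S : Finset H, S.Nonempty ∧ ∃ r : ℝ, 0 ≤ r ∧ r < 1 ∧
      ∀ (G : Type*) (ι : Type*) [Group G] [MulAction G ι] (ψ : H →* G) (φ : ι → H),
        (∀ h i, φ (ψ h • i) = h * φ i) →
        ‖∑ s ∈ S, (1 + Ell2.translate ι (ψ s))‖ ≤ r * (2 * S.card) := by
  obtain ⟨S, hS, δ, hδ, hm⟩ := exists_moved_of_not_isAmenableGroup hH
  have hS0 : (1 : ℝ) ≤ S.card := by exact_mod_cast hS.card_pos
  -- By the parallelogram law, a unit vector displaced by at least `δ / 2` has norm at most `η < 2`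
  -- when added to its translate. The summands `1` in the averaging operator are there for this: a
  -- sum of translates alone need not shrink (it is isometric for a single `s`).
  set η : ℝ := √(4 - (δ / 2) ^ 2)
  have hη : η < 2 := by
    rw [Real.sqrt_lt' two_pos]
    have : 0 < (δ / 2) ^ 2 := by positivity
    linarith
  have hη0 : 0 ≤ η := Real.sqrt_nonneg _
  -- One summand contributes at most `η` and each of the others at most `2`.
  refine ⟨S, hS, (2 * S.card - (2 - η)) / (2 * S.card), ?_, ?_, ?_⟩
  · have : 0 ≤ 2 * (S.card : ℝ) - (2 - η) := by linarith
    positivity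
  · rw [div_lt_one (by positivity)]
    linarith
  intro G ι _ _ ψ φ hφ
  rw [div_mul_cancel₀ _ (by positivity)]
  refine ContinuousLinearMap.opNorm_le_of_unit_norm (𝕜 := ℂ) (by linarith) fun ξ hξ => ?_
  -- The density `|ξ|²`, pushed forward along `φ`, is a finitely additive probability measure on
  -- `H`, so some `s` in `S` moves it by at least `δ`.
  obtain ⟨s, hs, A, hA⟩ := hm
    (fun A => ‖Ell2.pullback id Function.injective_id (φ ⁻¹' A) ξ‖ ^ 2) (fun A => by positivity)
    (by
      have e : Ell2.pullback id Function.injective_id (φ ⁻¹' univ) ξ = ξ := by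
        ext i
        simp [Ell2.pullback_apply]
      simp only [e, hξ, one_pow])
    (fun A B hAB => by
      have hs := Ell2.summable_norm_sq ξ
      simp only [Ell2.norm_sq_pullback, id, preimage_union]
      rw [← (hs.indicator _).tsum_add (hs.indicator _),
        indicator_union_of_disjoint (hAB.preimage φ)])
  have hd := hA.trans (Ell2.abs_sub_le_norm_translate_sub φ (ψ s) s (hφ s) ξ hξ A)
  have hmove : ‖ξ + Ell2.translate ι (ψ s) ξ‖ ≤ η := by
    refine Real.le_sqrt_of_sq_le ?_
    have hp := parallelogram_law_with_norm ℂ ξ (Ell2.translate ι (ψ s) ξ)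
    rw [Ell2.norm_translate, hξ, norm_sub_rev] at hp
    have : (δ / 2) ^ 2 ≤ ‖Ell2.translate ι (ψ s) ξ - ξ‖ ^ 2 := by
      gcongr
      linarith
    nlinarith
  have htriv : ∀ t, ‖ξ + Ell2.translate ι (ψ t) ξ‖ ≤ 2 := fun t => by
    refine (norm_add_le _ _).trans ?_
    rw [Ell2.norm_translate, hξ]
    norm_num
  have happ : (∑ t ∈ S, (1 + Ell2.translate ι (ψ t))) ξ =
      ∑ t ∈ S, (ξ + Ell2.translate ι (ψ t) ξ) := by
    simp
  classical
  rw [happ, ← Finset.add_sum_erase _ _ hs]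
  calc _ ≤ η + ∑ t ∈ S.erase s, (2 : ℝ) := (norm_add_le _ _).trans
        (add_le_add hmove (norm_sum_le_of_le _ fun t _ => htriv t))
    _ = 2 * S.card - (2 - η) := by
      rw [Finset.sum_const, Finset.card_erase_of_mem hs, nsmul_eq_mul,
        Nat.cast_sub (Nat.one_le_iff_ne_zero.2 hS.card_ne_zero)]
      push_cast
      ring

namespace GroupBundle

open ArrowGroupoid

variable {H : Type*} [Group H]

/-! ### The action of `ℤ₂ × H` on the fibers -/

/-- Left multiplication by the sections `arrow g`. -/
instance : MulAction (Z2 × H) (GroupBundle H) where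
  smul g
    | x i j => x i j
    | y n i => y (g.1 * n) i
    | z k i => z (g * k) i
    | eps k => eps (g * k)
  one_smul a := by
    change (match a with
      | x i j => x i j
      | y n i => y ((1 : Z2 × H).1 * n) i
      | z k i => z (1 * k) i
      | eps k => eps (1 * k) : GroupBundle H) = a
    cases a <;> simp
  mul_smul g h a := by
    rcases a with _ | _ | _ | _
    · rfl
    · exact congrArg (y · _) (mul_assoc _ _ _)
    · exact congrArg (z · _) (mul_assoc _ _ _)
    · exact congrArg eps (mul_assoc _ _ _)

theorem base_smul (g : Z2 × H) (a : GroupBundle H) : base (g • a) = base a := by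
  cases a <;> rfl

theorem comp_arrow_eq_smul (g : Z2 × H) (p : BasePoint) (a : GroupBundle H)
    (h : src (arrow g p) = rng a) : comp (arrow g p) a h = g • a := by
  obtain rfl : p = base a := by
    rw [src_arrow] at h
    exact arrow_one_injective h
  cases a <;> rfl

instance (w : units (GroupBundle H)) : MulAction (Z2 × H) (Fiber w) where
  smul g γ := ⟨g • γ.1, by rw [src_def, base_smul]; exact γ.2⟩
  one_smul γ := Subtype.ext (one_smul _ γ.1)
  mul_smul g h γ := Subtype.ext (mul_smul g h γ.1)

theorem coe_smul {w : units (GroupBundle H)} (g : Z2 × H) (γ : Fiber w) :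
    (g • γ : Fiber w).1 = g • γ.1 := rfl

theorem base_fiber {w : units (GroupBundle H)} (γ : Fiber w) : base γ.1 = base w.1 := by
  have h := congrArg base γ.2
  rwa [src_def, base_arrow] at h

theorem mulInv_mem_range_arrow {w : units (GroupBundle H)} (g : Z2 × H) (η γ : Fiber w) :
    mulInv η γ ∈ range (arrow g) ↔ η = g • γ := by
  constructor
  · rintro ⟨p, hp⟩
    refine Subtype.ext ?_
    rw [coe_smul, ← mulInv_comp η γ, ← comp_arrow_eq_smul g p γ.1
      (by rw [hp]; exact src_mulInv η γ)]
    exact comp_congr _ _ hp.symm rfl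
  · rintro rfl
    refine ⟨base γ.1, ?_⟩
    obtain ⟨γ, hγ⟩ := γ
    rcases γ with _ | _ | _ | _
    · rfl
    · exact congrArg (y · _) (mul_inv_cancel_right _ _).symm
    · exact congrArg (z · _) (mul_inv_cancel_right _ _).symm
    · exact congrArg eps (mul_inv_cancel_right _ _).symm

/-- The indicator function of the range of `arrow g`. -/
noncomputable def sectionIndicator (g : Z2 × H) : algC (GroupBundle H) :=
  ⟨(range (arrow g)).indicator fun _ => 1, by
    refine steinberg_le_algC _ (Submodule.subset_span ⟨_, (isOpenMap_arrow g).isOpen_range,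
      isCompact_range (continuous_arrow g), ?_, rfl⟩)
    rw [← image_univ]
    exact isBisection_image_arrow g univ⟩

/-- The coefficient at `(η, γ)` is `1` exactly when `ηγ⁻¹` lies in `U_g`, that is, when `η = gγ`. -/
theorem leftRegular_sectionIndicator (w : units (GroupBundle H)) (g : Z2 × H) :
    leftRegular w (sectionIndicator g) = Ell2.translate (Fiber w) g := by
  classical
  refine ext_delta fun γ η => ?_
  rw [leftRegular_delta, Ell2.translate_apply]
  change (range (arrow g)).indicator (fun _ => (1 : ℂ)) (mulInv η γ) = _
  simp only [indicator, mulInv_mem_range_arrow, delta, lp.single_apply, Pi.single_apply,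
    inv_smul_eq_iff]

theorem leftRegular_add (w : units (GroupBundle H)) (f g : algC (GroupBundle H)) :
    leftRegular w (f + g) = leftRegular w f + leftRegular w g :=
  ext_delta fun γ η => by simp [leftRegular_delta]

theorem leftRegular_sub (w : units (GroupBundle H)) (f g : algC (GroupBundle H)) :
    leftRegular w (f - g) = leftRegular w f - leftRegular w g :=
  ext_delta fun γ η => by simp [leftRegular_delta]

theorem leftRegular_smul (w : units (GroupBundle H)) (c : ℂ) (f : algC (GroupBundle H)) :
    leftRegular w (c • f) = c • leftRegular w f :=
  ext_delta fun γ η => by simp [leftRegular_delta]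

/-- Products can thus be taken in `ℂ[G]` and carried to operators by an algebra homomorphism, with
no convolution on `𝒞(𝒢)`. -/
theorem exists_leftRegular_eq_lift (c : MonoidAlgebra ℂ (Z2 × H)) :
    ∃ f : algC (GroupBundle H), ∀ w,
      leftRegular w f = MonoidAlgebra.lift ℂ _ _ (Ell2.translate (Fiber w)) c := by
  induction c using MonoidAlgebra.induction_on with
  | of g => exact ⟨sectionIndicator g, fun w => by
      rw [leftRegular_sectionIndicator, MonoidAlgebra.lift_of]⟩
  | add c d hc hd =>
    obtain ⟨f, hf⟩ := hc
    obtain ⟨g, hg⟩ := hd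
    exact ⟨f + g, fun w => by rw [leftRegular_add, hf, hg, map_add]⟩
  | smul a c hc =>
    obtain ⟨f, hf⟩ := hc
    exact ⟨a • f, fun w => by rw [leftRegular_smul, hf, map_smul]⟩

/-! ### A singular element that does not vanish at infinity along `Y` -/

/-- The `H`-coordinate of an arrow over `Z` or `eps`. -/
def coord : GroupBundle H → H
  | z g _ => g.2
  | eps g => g.2
  | _ => 1

/-- The base points with fiber `ℤ₂ × H`. -/
def largeFibers : Set BasePoint := insert .eps (range .z)

/-- This is the equivariance required by the spectral gap over `Z` and `eps`. -/
theorem coord_smul {a : GroupBundle H} (ha : base a ∈ largeFibers) (h : H) :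
    coord (MonoidHom.inr Z2 H h • a) = h * coord a := by
  rcases a with _ | _ | _ | _
  · simp [largeFibers, base] at ha
  · simp [largeFibers, base] at ha
  · rfl
  · rfl

/-- Averaging over `H` is therefore invisible over `X` and `Y`. -/
theorem inr_smul {a : GroupBundle H} (ha : base a ∉ largeFibers) (h : H) :
    MonoidHom.inr Z2 H h • a = a := by
  rcases a with _ | _ | _ | _
  · rfl
  · exact congrArg (y · _) (one_mul _)
  · simp [largeFibers, base] at ha
  · simp [largeFibers, base] at ha

/-- The indicator of `U_(0,1)` minus the indicator of `U_(1,1)`. -/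
noncomputable def alternatingIndicator : algC (GroupBundle H) :=
  sectionIndicator 1 - sectionIndicator (Multiplicative.ofAdd 1, 1)

theorem alternatingIndicator_x (i j : ℕ) :
    (alternatingIndicator : algC (GroupBundle H)).1 (x i j) = 0 := by
  have : ∀ g : Z2 × H, (x i j : GroupBundle H) ∈ range (arrow g) := fun g => ⟨.x i j, rfl⟩
  change (range (arrow 1)).indicator (fun _ => (1 : ℂ)) (x i j) -
    (range (arrow (Multiplicative.ofAdd 1, 1))).indicator (fun _ => (1 : ℂ)) (x i j) = 0
  simp [this]

theorem alternatingIndicator_y (i : ℕ) :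
    (alternatingIndicator : algC (GroupBundle H)).1 (y 1 i) = 1 := by
  have h1 : (y 1 i : GroupBundle H) ∈ range (arrow 1) := ⟨.y i, rfl⟩
  have h2 : (y 1 i : GroupBundle H) ∉ range (arrow (Multiplicative.ofAdd 1, 1)) := by
    rintro ⟨p, hp⟩
    rcases p with _ | _ | _ | _ <;> simp [arrow] at hp
  change (range (arrow 1)).indicator (fun _ => (1 : ℂ)) (y 1 i) -
    (range (arrow (Multiplicative.ofAdd 1, 1))).indicator (fun _ => (1 : ℂ)) (y 1 i) = 1
  simp [h1, h2]

open Classical in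
/-- The operators `λ_w(f)`, `f` the alternating indicator, at the units `w` in `X` and `Y`. -/
noncomputable def limitFamily : OperatorFamilies (GroupBundle H) :=
  ⟨fun w => if base w.1 ∈ largeFibers then 0 else leftRegular w alternatingIndicator,
    memℓp_infty ⟨‖regRep _ (alternatingIndicator : algC (GroupBundle H))‖, by
      rintro _ ⟨w, rfl⟩
      dsimp only
      split_ifs
      · simp
      · exact lp.norm_apply_le_norm (by simp) (regRep (GroupBundle H) alternatingIndicator) w⟩⟩

theorem limitFamily_of_mem {w : units (GroupBundle H)} (hw : base w.1 ∈ largeFibers) :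
    limitFamily w = 0 := if_pos hw

theorem limitFamily_of_notMem {w : units (GroupBundle H)} (hw : base w.1 ∉ largeFibers) :
    limitFamily w = leftRegular w alternatingIndicator := if_neg hw

/-- For non-amenable `H`, convolving the alternating indicator with powers of an averaging element
of `ℂ[H]` leaves it unchanged over `X` and `Y` and lets it tend to `0` over `Z` and `eps`. -/
theorem limitFamily_mem_redAlg (hH : ¬ IsAmenableGroup H) :
    (limitFamily : OperatorFamilies (GroupBundle H)) ∈ redAlg (GroupBundle H) := by
  obtain ⟨S, hS, r, hr0, hr1, hgap⟩ := exists_norm_sum_translate_le hH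
  have hS0 : (2 * S.card : ℂ) ≠ 0 := by simpa using hS.ne_empty
  -- The factor `1 / (2 |S|)` makes the coefficients sum to `1`: `μ` is the identity where `H` acts
  -- trivially and has norm at most `r` over the large fibers.
  let μ : MonoidAlgebra ℂ (Z2 × H) :=
    (2 * S.card : ℂ)⁻¹ • ∑ s ∈ S, (1 + MonoidAlgebra.of ℂ _ (MonoidHom.inr Z2 H s))
  let P : MonoidAlgebra ℂ (Z2 × H) := MonoidAlgebra.of ℂ _ 1 -
    MonoidAlgebra.of ℂ _ (Multiplicative.ofAdd 1, 1)
  have hP : ∀ w : units (GroupBundle H), MonoidAlgebra.lift ℂ _ _ (Ell2.translate (Fiber w)) P =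
      leftRegular w alternatingIndicator := fun w => by
    rw [map_sub, MonoidAlgebra.lift_of, MonoidAlgebra.lift_of, ← leftRegular_sectionIndicator,
      ← leftRegular_sectionIndicator, ← leftRegular_sub]
    rfl
  have hμ : ∀ w : units (GroupBundle H), MonoidAlgebra.lift ℂ _ _ (Ell2.translate (Fiber w)) μ =
      (2 * S.card : ℂ)⁻¹ •
        ∑ s ∈ S, (1 + Ell2.translate (Fiber w) (MonoidHom.inr Z2 H s)) := fun w => by
    simp [μ, -MonoidAlgebra.of_apply, MonoidAlgebra.lift_of]
  have hsmall : ∀ w : units (GroupBundle H), base w.1 ∉ largeFibers →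
      MonoidAlgebra.lift ℂ _ _ (Ell2.translate (Fiber w)) μ = 1 := fun w hw => by
    have : ∀ s, Ell2.translate (Fiber w) (MonoidHom.inr Z2 H s) = 1 := fun s => by
      ext ξ γ
      rw [Ell2.translate_apply, ← map_inv]
      exact congrArg ξ (Subtype.ext (inr_smul (by rwa [base_fiber γ]) s⁻¹))
    rw [hμ]
    simp only [this, Finset.sum_const]
    rw [← Nat.cast_smul_eq_nsmul ℂ, ← two_smul ℂ (1 : Ell2 (Fiber w) →L[ℂ] Ell2 (Fiber w)),
      smul_smul, smul_smul, mul_assoc, mul_comm (S.card : ℂ), inv_mul_cancel₀ hS0, one_smul]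
  have hlarge : ∀ w : units (GroupBundle H), base w.1 ∈ largeFibers →
      ‖MonoidAlgebra.lift ℂ _ _ (Ell2.translate (Fiber w)) μ‖ ≤ r := fun w hw => by
    rw [hμ, norm_smul, norm_inv, inv_mul_le_iff₀ (norm_pos_iff.2 hS0)]
    refine (hgap (Z2 × H) (Fiber w) (MonoidHom.inr Z2 H) (fun γ => coord γ.1)
      fun h γ => coord_smul (by rwa [base_fiber γ]) h).trans_eq ?_
    simp [mul_comm]
  set C := ‖regRep _ (alternatingIndicator : algC (GroupBundle H))‖
  choose f hf using fun k : ℕ => exists_leftRegular_eq_lift (P * μ ^ k)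
  have hbound : ∀ k, ‖regRep _ (f k) - limitFamily‖ ≤ C * r ^ k := fun k => by
    refine lp.norm_le_of_forall_le (by positivity) fun w => ?_
    change ‖leftRegular w (f k) - limitFamily w‖ ≤ _
    rw [hf, map_mul, map_pow, hP]
    by_cases hw : base w.1 ∈ largeFibers
    · rw [limitFamily_of_mem hw, sub_zero]
      refine (norm_mul_le _ _).trans ?_
      gcongr
      · exact lp.norm_apply_le_norm (by simp) (regRep (GroupBundle H) alternatingIndicator) w
      -- The exponent `0` is treated apart: there the power is the identity, of norm at most `1`.
      · rcases k with _ | k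
        · rw [pow_zero, pow_zero]
          exact ContinuousLinearMap.norm_id_le
        · refine (norm_pow_le' _ k.succ_pos).trans ?_
          gcongr
          exact hlarge w hw
    · rw [limitFamily_of_notMem hw, hsmall w hw, one_pow, mul_one, sub_self, norm_zero]
      positivity
  have hlim : Tendsto (fun k => regRep _ (f k)) atTop
      (𝓝 (limitFamily : OperatorFamilies (GroupBundle H))) := by
    rw [tendsto_iff_norm_sub_tendsto_zero]
    refine squeeze_zero (fun _ => norm_nonneg _) hbound ?_
    simpa using (tendsto_pow_atTop_nhds_zero_of_lt_one hr0 hr1).const_mul C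
  exact mem_closure_of_tendsto hlim (Eventually.of_forall fun k => ⟨f k, rfl⟩)

theorem exists_mem_singularIdeal (hH : ¬ IsAmenableGroup H) :
    ∃ a ∈ singularIdeal (GroupBundle H), ∀ i, jMap a (y 1 i) = 1 := by
  have hsmall : ∀ γ : GroupBundle H, base γ ∉ largeFibers →
      jMap ⟨limitFamily, limitFamily_mem_redAlg hH⟩ γ = alternatingIndicator.1 γ := by
    intro γ hγ
    rw [← jMap_toRedAlg alternatingIndicator]
    exact congrArg (fun T : Ell2 (Fiber (srcUnit γ)) →L[ℂ] Ell2 (Fiber (srcUnit γ)) =>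
      T (delta (unitArrow (srcUnit γ))) (toFiber γ))
      (limitFamily_of_notMem (w := srcUnit γ) (by rwa [← base_fiber (toFiber γ)]))
  have hlarge : ∀ γ : GroupBundle H, base γ ∈ largeFibers →
      jMap ⟨limitFamily, limitFamily_mem_redAlg hH⟩ γ = 0 := by
    intro γ hγ
    exact congrArg (fun T : Ell2 (Fiber (srcUnit γ)) →L[ℂ] Ell2 (Fiber (srcUnit γ)) =>
      T (delta (unitArrow (srcUnit γ))) (toFiber γ))
      (limitFamily_of_mem (w := srcUnit γ) (by rwa [← base_fiber (toFiber γ)]))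
  refine ⟨⟨limitFamily, limitFamily_mem_redAlg hH⟩, ?_, fun i => ?_⟩
  · have hx : ∀ i j, jMap ⟨limitFamily, limitFamily_mem_redAlg hH⟩ (x i j : GroupBundle H) = 0 :=
      fun i j => (hsmall _ (by simp [largeFibers, base])).trans (alternatingIndicator_x i j)
    refine eq_empty_iff_forall_notMem.2 fun γ hγ => ?_
    have hne := interior_subset hγ
    rcases γ with ⟨i, j⟩ | ⟨n, i⟩ | ⟨g, i⟩ | g
    · exact hne (hx i j)
    -- Every neighbourhood of `y n i` contains some `x i j`, where the function vanishes.
    · obtain ⟨j, hj⟩ := ((tendsto_arrow_x ((n, 1) : Z2 × H) i).eventually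
        (isOpen_interior.mem_nhds hγ)).exists
      exact interior_subset hj (hx i j)
    · exact hne (hlarge _ (by simp [largeFibers, base]))
    · exact hne (hlarge _ (by simp [largeFibers, base]))
  · exact (hsmall _ (by simp [largeFibers, base])).trans (alternatingIndicator_y i)

end GroupBundle

/-! ### Non-density, by comparison of values along `Y` -/

theorem mainTheorem2 (H : Type*) [Group H] [Group.FG H] (hH : ¬ IsAmenableGroup H) :
    ArrowGroupoid.IsAmple (GroupBundle H) ∧
    ¬ Dense {a : ArrowGroupoid.singularIdeal (GroupBundle H) |
        ∃ f : GroupBundle H → ℂ, ∃ hf : f ∈ ArrowGroupoid.algC (GroupBundle H),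
          ArrowGroupoid.toRedAlg ⟨f, hf⟩ = a.1} ∧
    ¬ Dense {a : ArrowGroupoid.singularIdeal (GroupBundle H) |
        ∃ f : GroupBundle H → ℂ, ∃ hf : f ∈ ArrowGroupoid.steinberg (GroupBundle H),
          ArrowGroupoid.toRedAlg ⟨f, ArrowGroupoid.steinberg_le_algC (GroupBundle H) hf⟩ = a.1} := by
  have key : ¬ Dense {a : ArrowGroupoid.singularIdeal (GroupBundle H) |
      ∃ f : GroupBundle H → ℂ, ∃ hf : f ∈ ArrowGroupoid.algC (GroupBundle H),
        ArrowGroupoid.toRedAlg ⟨f, hf⟩ = a.1} := by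
    intro hd
    obtain ⟨a, ha, ha1⟩ := GroupBundle.exists_mem_singularIdeal hH
    obtain ⟨⟨_, hb⟩, ⟨f, hf, rfl⟩, hdist⟩ :=
      Metric.mem_closure_iff.1 (hd ⟨a, ha⟩) (1 / 2) (by norm_num)
    have hsing : interior (Function.support f) = ∅ := by
      have h := hb
      rwa [ArrowGroupoid.singularIdeal, mem_ofPred_eq, ArrowGroupoid.jMap_toRedAlg] at h
    have hlim := GroupBundle.tendsto_zero_of_interior_support_eq_empty hf hsing 1
    -- At this `i` the approximant has modulus below `1 / 2` while `a` has value `1`, so they differ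
    -- by more than `1 / 2`, against the contractivity of `jMap`.
    obtain ⟨i, hi⟩ := (hlim.norm.eventually_lt_const
      (show ‖(0 : ℂ)‖ < 1 / 2 by norm_num)).exists
    have h1 := ArrowGroupoid.norm_jMap_le
      (a - ArrowGroupoid.toRedAlg ⟨f, hf⟩) (GroupBundle.y 1 i)
    rw [ArrowGroupoid.jMap_sub, ArrowGroupoid.jMap_toRedAlg, ha1] at h1
    have h2 : ‖((a - ArrowGroupoid.toRedAlg ⟨f, hf⟩ : ArrowGroupoid.redAlg (GroupBundle H)) :
        ArrowGroupoid.OperatorFamilies (GroupBundle H))‖ < 1 / 2 := by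
      rw [Subtype.dist_eq, dist_eq_norm] at hdist
      exact hdist
    have h3 := norm_sub_norm_le (1 : ℂ) (f (GroupBundle.y 1 i))
    rw [norm_one] at h3
    linarith
  refine ⟨GroupBundle.isAmple, key, fun hd => key (hd.mono ?_)⟩
  rintro a ⟨f, hf, h⟩
  exact ⟨f, _, h⟩
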